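/- **Setting.** Let $N\ge 1$, $K\ge 0$ and $M=N+K$. A network has converter nodes $1,\dots,N$, interior nodes $N+1,\dots,M$ and one grounded node $M+1$. All transfer functions are real rational. The branch between nodes $i\neq j$ has a $2\times2$ transfer function matrix $Y_{ij}(s)$ (put $Y_{ij}=0$ if there is no branch). Let ${\bf Y}(s)$ be the $2M\times 2M$ matrix with $2\times 2$ blocks ${\bf Y}_{ij}=-Y_{ij}$ for $i\ne j$, and ${\bf Y}_{ii}=\sum_{j\ne i,\ j\le M+1}Y_{ij}$. Partition ${\bf Y}=\begin{bmatrix}{\bf Y}_1&{\bf Y}_2\\{\bf Y}_3&{\bf Y}_4\end{bmatrix}$ with ${\bf Y}_1$ of size $2N\times2N$, and put ${\bf Y}_{\rm grid}={\bf Y}_1-{\bf Y}_2{\bf Y}_4^{-1}{\bf Y}_3$; ${\bf Y}_4$ and ${\bf Y}_{\rm grid}$ are assumed invertible as rational matrices. Converter $i$ has a $2\times2$ admittance ${\bf Y}_{{\rm C},i}(s)$, a capacity ratio $S_i>0$ and an angle $\theta_i\in\mathbb R$. Put ${\bf S}={\rm diag}(S_i)$, ${\bf Y}_{\rm C}^N={\rm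 diag}({\bf Y}_{{\rm C},i})$, $e^{J\theta_i}=\begin{bmatrix}\cos\theta_i&-\sin\theta_i\\ \sin\theta_i&\cos\theta_i\end{bmatrix}$ and $e^{J\vartheta}={\rm diag}(e^{J\theta_i})$. Let $\omega_0>0$, $\widetilde\epsilon\in\mathbb R$, $\widetilde F_\epsilon^{-1}(s)=\begin{bmatrix}s/\omega_0+\widetilde\epsilon&-1\\1&s/\omega_0+\widetilde\epsilon\end{bmatrix}$ and ${\bf D}={\rm diag}(D_1,\dots,D_N)$ with all $D_i>0$. Define $$\widetilde{\bf Y}_{\rm grid}=({\bf S}^{-1/2}\otimes I_2)\,{\bf Y}_{\rm grid}\,({\bf S}^{-1/2}{\bf D}\otimes\widetilde F_\epsilon^{-1}),\qquad \widetilde{\bf Y}_{{\rm C},i}=D_i{\bf Y}_{{\rm C},i}\widetilde F_\epsilon^{-1},$$ $$G=e^{J\vartheta}{\bf Y}_{\rm C}^Ne^{-J\vartheta}({\bf D}\otimes\widetilde F_\epsilon^{-1}),\qquad H=\widetilde{\bf Y}_{\rm grid}^{-1}.$$ **Terminology.** $\mathcal{RH}_\infty$ is the set of real rational proper matrices without poles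 in ${\rm Re}\,s\ge0$. The feedback loop of $G$ and $H$ is *stable* if $I+HG$ is invertible as a rational matrix and $$G\#H=\begin{bmatrix}(I+HG)^{-1}&(I+HG)^{-1}H\\G(I+HG)^{-1}&G(I+HG)^{-1}H\end{bmatrix}\in\mathcal{RH}_\infty .$$ $\overline\sigma$ and $\underline\sigma$ are the largest and smallest singular values; at a pole $j\omega$ of $\widetilde{\bf Y}_{\rm grid}$ (possibly $\omega=\infty$), $\underline\sigma(\widetilde{\bf Y}_{\rm grid}(j\omega))\in[0,\infty]$ is the limit inferior of its values at nearby frequencies. A complex matrix $A$ is *sectorial* if $x^*Ax\ne0$ for all unit vectors $x$; then $A=T^*DT$ with $T$ nonsingular and $D={\rm diag}(e^{j\phi_k})$, where the $\phi_k$ can be chosen with $\max_k\phi_k-\min_k\phi_k<\pi$. These are the *phases* of $A$ (determined up to order and a common multiple of $2\pi$), and $\overline\phi(A)$, $\underline\phi(A)$ are the largest and the smallest one. **Proposition 1 (Decentralized stability conditions).** Suppose the open-loop systems are stable: $\widetilde{\bf Y}_{{\rm C},i}\in\mathcal{RH}_\infty$ for all $i$, and $\widetilde{\bf Y}_{\rm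 grid}^{-1}\in\mathcal{RH}_\infty$. Suppose that for each $\omega\in[0,\infty]$ at least one of the following holds. (i) $\max_i\overline\sigma(\widetilde{\bf Y}_{{\rm C},i}(j\omega))<\underline\sigma(\widetilde{\bf Y}_{\rm grid}(j\omega))$. (ii) All $\widetilde{\bf Y}_{{\rm C},i}(j\omega)$ are sectorial, $\widetilde{\bf Y}_{\rm grid}$ has no pole at $j\omega$ and $\widetilde{\bf Y}_{\rm grid}(j\omega)$ is sectorial, and, for some admissible choice of the multiples of $2\pi$ in the phases, $$\max_i\overline\phi(\widetilde{\bf Y}_{{\rm C},i}(j\omega))<\pi-\overline\phi(\widetilde{\bf Y}_{\rm grid}^{-1}(j\omega)),\qquad \min_i\underline\phi(\widetilde{\bf Y}_{{\rm C},i}(j\omega))>-\pi-\underline\phi(\widetilde{\bf Y}_{\rm grid}^{-1}(j\omega)),$$ $$\max_i\overline\phi(\widetilde{\bf Y}_{{\rm C},i}(j\omega))-\min_i\underline\phi(\widetilde{\bf Y}_{{\rm C},i}(j\omega))<\pi .$$ Then the multi-converter system, represented by the rescaled feedback loop of $G$ and $H$, is stable. If moreover the converter admittances ${\bf Y}_{{\rm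 C},i}$ have no poles in ${\rm Re}\,s\ge0$, then the loop before rescaling, with $G_0=({\bf S}\otimes I_2)e^{J\vartheta}{\bf Y}_{\rm C}^Ne^{-J\vartheta}$ and $H_0={\bf Y}_{\rm grid}^{-1}$, is also free of instability: $I+H_0G_0$ is invertible as a rational matrix, and $G_0\#H_0$ has no poles in ${\rm Re}\,s\ge0$. -/

import Mathlib

open scoped ENNReal Kronecker Topology Matrix

noncomputable section

/-! ## Real rational transfer function matrices -/

/-- A real rational transfer function (in the Laplace variable `s = RatFunc.X`). -/
abbrev TF : Type := RatFunc ℝ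

/-- The Laplace variable `s`. -/
def sVar : TF := RatFunc.X

/-- `f` has no pole in the closed right half plane `Re s ≥ 0`
(`num` and `denom` of a `RatFunc` are coprime). -/
def TF.NoUnstablePole (f : TF) : Prop :=
  ∀ s : ℂ, 0 ≤ s.re → Polynomial.aeval s f.denom ≠ 0

/-- `f` is proper. -/
def TF.Proper (f : TF) : Prop := f.num.natDegree ≤ f.denom.natDegree

/-- Entrywise absence of poles in the closed right half plane. -/
def NoUnstablePole {m n : Type*} (G : Matrix m n TF) : Prop :=
  ∀ i j, (G i j).NoUnstablePole

/-- `G ∈ RH∞`: real rational, proper and stable. -/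
def RHInf {m n : Type*} (G : Matrix m n TF) : Prop :=
  ∀ i j, (G i j).Proper ∧ (G i j).NoUnstablePole

/-- The value `f(jω)` for a frequency `ω ∈ [0,∞]`. At `ω = ∞` it is the limit of a proper `f`,
i.e. the quotient of the coefficients of degree `natDegree denom`. Meaningful if `f` has no pole
at `jω`. -/
def TF.resp (f : TF) (ω : ℝ≥0∞) : ℂ :=
  if ω = ⊤ then
    ((f.num.coeff f.denom.natDegree / f.denom.leadingCoeff : ℝ) : ℂ)
  else RatFunc.eval (algebraMap ℝ ℂ) (Complex.I * (ω.toReal : ℂ)) f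

/-- `f` has no pole at `jω`, `ω ∈ [0,∞]`. -/
def TF.RegularAt (f : TF) (ω : ℝ≥0∞) : Prop :=
  if ω = ⊤ then f.Proper else Polynomial.aeval (Complex.I * (ω.toReal : ℂ)) f.denom ≠ 0

/-- The frequency response `G(jω)`, `ω ∈ [0,∞]`. -/
def freqResp {m n : Type*} (G : Matrix m n TF) (ω : ℝ≥0∞) : Matrix m n ℂ :=
  Matrix.of fun i j => (G i j).resp ω

/-- `G` has no pole at `jω`, `ω ∈ [0,∞]`. -/
def RegularAt {m n : Type*} (G : Matrix m n TF) (ω : ℝ≥0∞) : Prop :=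
  ∀ i j, (G i j).RegularAt ω

/-! ## Gains and phases of complex matrices -/

section GainPhase

variable {n : Type*} [Fintype n] [DecidableEq n]

/-- Largest singular value. -/
def sigmaMax (A : Matrix n n ℂ) : ℝ := (Matrix.toEuclideanLin A).singularValues 0

/-- Smallest singular value (Mathlib's singular values are decreasing and indexed from `0`). -/
def sigmaMin (A : Matrix n n ℂ) : ℝ :=
  (Matrix.toEuclideanLin A).singularValues (Fintype.card n - 1)

/-- Smallest singular value of `G(jω)` in `[0,∞]`. If `jω` is a pole of `G`, it is understood as
the limit (inferior) along the neighbouring frequencies. -/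
def sigmaMinAt (G : Matrix n n TF) (ω : ℝ≥0∞) : ℝ≥0∞ :=
  open Classical in
  if RegularAt G ω then ENNReal.ofReal (sigmaMin (freqResp G ω))
  else Filter.liminf (fun t : ℝ≥0∞ => ENNReal.ofReal (sigmaMin (freqResp G t))) (𝓝[≠] ω)

/-- The numerical range `W(A) = {x* A x : ‖x‖ = 1}`. -/
def numRange (A : Matrix n n ℂ) : Set ℂ :=
  {z | ∃ x : n → ℂ, star x ⬝ᵥ x = 1 ∧ z = star x ⬝ᵥ (A *ᵥ x)}

/-- `A` is sectorial. -/
def Sectorial (A : Matrix n n ℂ) : Prop := (0 : ℂ) ∉ numRange A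

/-- `φ` lists the phases of `A`: there is a sectorial decomposition `A = T* D T` with `T`
nonsingular, `D = diag(e^{j φ_k})`, and the angles `φ_k` are chosen such that
`max φ - min φ < π`. Such a list exists exactly for sectorial `A`, and it is unique up to order
and a common shift by a multiple of `2π`. -/
def IsPhases (A : Matrix n n ℂ) (φ : n → ℝ) : Prop :=
  (∃ T : Matrix n n ℂ, IsUnit T.det ∧
    A = Tᴴ * Matrix.diagonal (fun k => Complex.exp ((φ k : ℂ) * Complex.I)) * T) ∧
  ∀ k l, φ k - φ l < Real.pi

end GainPhase

/-! ## Feedback loops -/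

section Feedback

variable {n : Type*} [Fintype n] [DecidableEq n]

/-- The Gang of Four matrix `G # H`. -/
def gangOfFour (G H : Matrix n n TF) : Matrix (n ⊕ n) (n ⊕ n) TF :=
  Matrix.fromBlocks ((1 + H * G)⁻¹) ((1 + H * G)⁻¹ * H)
    (G * (1 + H * G)⁻¹) (G * (1 + H * G)⁻¹ * H)

/-- The feedback loop of `G` and `H` is stable: it is well defined (`I + HG` is invertible as a
rational matrix) and `G # H ∈ RH∞`. -/
def FeedbackStable (G H : Matrix n n TF) : Prop :=
  IsUnit (1 + H * G).det ∧ RHInf (gangOfFour G H)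

/-- The feedback loop of `G` and `H` is well defined and none of its closed-loop transfer
functions has a pole in the closed right half plane (they may be improper when `G` or `H` is). -/
def FeedbackNoUnstablePole (G H : Matrix n n TF) : Prop :=
  IsUnit (1 + H * G).det ∧ NoUnstablePole (gangOfFour G H)

end Feedback

/-! ## Multi-converter systems -/

/-- The data of a multi-converter system with `N` converter nodes, `K` interior nodes and a
grounded node. All transfer functions are real rational and otherwise arbitrary. -/
structure MultiConverterSystem (N K : ℕ) where
  /-- capacity ratios -/
  S : Fin N → ℝ
  S_pos : ∀ i, 0 < S i
  /-- steady-state angle differences -/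
  θ : Fin N → ℝ
  /-- converter admittances in local coordinates -/
  YC : Fin N → Matrix (Fin 2) (Fin 2) TF
  /-- dynamics of the line between two non-grounded nodes -/
  line : Fin N ⊕ Fin K → Fin N ⊕ Fin K → Matrix (Fin 2) (Fin 2) TF
  /-- dynamics of the branch between a node and the grounded node -/
  shunt : Fin N ⊕ Fin K → Matrix (Fin 2) (Fin 2) TF
  /-- nominal frequency -/
  ω₀ : ℝ
  ω₀_pos : 0 < ω₀

namespace MultiConverterSystem

variable {N K : ℕ} (sys : MultiConverterSystem N K)

/-- Block-diagonal matrix `diag(B_1, …, B_N)` with `2 × 2` blocks. -/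
def blockDiag (B : Fin N → Matrix (Fin 2) (Fin 2) TF) :
    Matrix (Fin N × Fin 2) (Fin N × Fin 2) TF :=
  (Matrix.blockDiagonal B).submatrix Prod.swap Prod.swap

/-- The rotation `e^{Jθ}`. -/
def rot (t : ℝ) : Matrix (Fin 2) (Fin 2) TF :=
  !![RatFunc.C (Real.cos t), -RatFunc.C (Real.sin t);
     RatFunc.C (Real.sin t), RatFunc.C (Real.cos t)]

/-- A real diagonal matrix as a matrix of constant transfer functions. -/
def constDiag (d : Fin N → ℝ) : Matrix (Fin N) (Fin N) TF :=
  Matrix.diagonal fun i => RatFunc.C (d i)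

/-- The block `Y_ij(s)` of the grounded Laplacian. (There is no line from a node to itself.) -/
def lapBlock (i j : Fin N ⊕ Fin K) : Matrix (Fin 2) (Fin 2) TF :=
  if i = j then sys.shunt i + ∑ k ∈ Finset.univ.erase i, sys.line i k else -sys.line i j

/-- Converter/converter part `Y₁` of the grounded Laplacian. -/
def Y₁ : Matrix (Fin N × Fin 2) (Fin N × Fin 2) TF :=
  Matrix.of fun p q => sys.lapBlock (Sum.inl p.1) (Sum.inl q.1) p.2 q.2

/-- Converter/interior part `Y₂` of the grounded Laplacian. -/
def Y₂ : Matrix (Fin N × Fin 2) (Fin K × Fin 2) TF :=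
  Matrix.of fun p q => sys.lapBlock (Sum.inl p.1) (Sum.inr q.1) p.2 q.2

/-- Interior/converter part `Y₃` of the grounded Laplacian. -/
def Y₃ : Matrix (Fin K × Fin 2) (Fin N × Fin 2) TF :=
  Matrix.of fun p q => sys.lapBlock (Sum.inr p.1) (Sum.inl q.1) p.2 q.2

/-- Interior/interior part `Y₄` of the grounded Laplacian. -/
def Y₄ : Matrix (Fin K × Fin 2) (Fin K × Fin 2) TF :=
  Matrix.of fun p q => sys.lapBlock (Sum.inr p.1) (Sum.inr q.1) p.2 q.2

/-- The network admittance `Y_grid(s) = Y₁ - Y₂ Y₄⁻¹ Y₃` (Kron reduction). -/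
def Ygrid : Matrix (Fin N × Fin 2) (Fin N × Fin 2) TF :=
  sys.Y₁ - sys.Y₂ * sys.Y₄⁻¹ * sys.Y₃

/-- `e^{Jϑ} Y_C^N(s) e^{-Jϑ}`. -/
def rotatedYC : Matrix (Fin N × Fin 2) (Fin N × Fin 2) TF :=
  blockDiag (fun i => rot (sys.θ i)) * blockDiag sys.YC * blockDiag (fun i => rot (-sys.θ i))

/-- The device dynamics `(S ⊗ I₂) e^{Jϑ} Y_C^N(s) e^{-Jϑ}`. -/
def devices : Matrix (Fin N × Fin 2) (Fin N × Fin 2) TF :=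
  (constDiag sys.S ⊗ₖ (1 : Matrix (Fin 2) (Fin 2) TF)) * sys.rotatedYC

/-- The inverse of the `2 × 2` transfer function matrix `F_ε(s)`. -/
def Finv (ε : ℝ) : Matrix (Fin 2) (Fin 2) TF :=
  !![sVar / RatFunc.C sys.ω₀ + RatFunc.C ε, -1;
     1, sVar / RatFunc.C sys.ω₀ + RatFunc.C ε]

/-- Rescaled network `(S^{-1/2} ⊗ I₂) Y_grid(s) (S^{-1/2} D ⊗ F_ε⁻¹(s))`. -/
def YgridT (D : Fin N → ℝ) (ε : ℝ) : Matrix (Fin N × Fin 2) (Fin N × Fin 2) TF :=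
  (constDiag (fun i => (Real.sqrt (sys.S i))⁻¹) ⊗ₖ (1 : Matrix (Fin 2) (Fin 2) TF)) *
    sys.Ygrid * (constDiag (fun i => (Real.sqrt (sys.S i))⁻¹ * D i) ⊗ₖ sys.Finv ε)

/-- Rescaled converter `D_i Y_{C,i}(s) F_ε⁻¹(s)`. -/
def YCT (D : Fin N → ℝ) (ε : ℝ) (i : Fin N) : Matrix (Fin 2) (Fin 2) TF :=
  RatFunc.C (D i) • (sys.YC i * sys.Finv ε)

/-- Rescaled device dynamics `e^{Jϑ} Y_C^N(s) e^{-Jϑ} (D ⊗ F_ε⁻¹(s))`. -/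
def devicesT (D : Fin N → ℝ) (ε : ℝ) : Matrix (Fin N × Fin 2) (Fin N × Fin 2) TF :=
  sys.rotatedYC * (constDiag D ⊗ₖ sys.Finv ε)

/-- The decentralized gain condition at the frequency `ω`. -/
def GainCondition (D : Fin N → ℝ) (ε : ℝ) (ω : ℝ≥0∞) : Prop :=
  (⨆ i, ENNReal.ofReal (sigmaMax (freqResp (sys.YCT D ε i) ω))) < sigmaMinAt (sys.YgridT D ε) ω

/-- The decentralized phase condition at the frequency `ω`: the matrices `Y_{C,i}(jω)` (rescaled)
have phases `φ i`, the inverse of the rescaled network has phases `ψ`, and a) to d) hold. -/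
def PhaseCondition (D : Fin N → ℝ) (ε : ℝ) (ω : ℝ≥0∞) : Prop :=
  ∃ (φ : Fin N → Fin 2 → ℝ) (ψ : Fin N × Fin 2 → ℝ),
    (∀ i, IsPhases (freqResp (sys.YCT D ε i) ω) (φ i)) ∧
    IsPhases (freqResp (sys.YgridT D ε)⁻¹ ω) ψ ∧
    (⨆ i, ⨆ k, φ i k) < Real.pi - ⨆ p, ψ p ∧
    (⨅ i, ⨅ k, φ i k) > -Real.pi - ⨅ p, ψ p ∧
    (RegularAt (sys.YgridT D ε) ω ∧ Sectorial (freqResp (sys.YgridT D ε) ω)) ∧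
    (⨆ i, ⨆ k, φ i k) - (⨅ i, ⨅ k, φ i k) < Real.pi

end MultiConverterSystem

end

/-!
The loop transfer matrix `H G` is stable, so everything is a matter of the determinant of the return
difference `I + τ H G`, which must not vanish on the closed right half plane and at infinity for
`τ = 1`.

*On the imaginary axis* it vanishes for no `τ ∈ [0, 1]`. Rotations commute with `F_ε⁻¹`, so `G(jω)`
is unitarily similar to the block diagonal matrix of the rescaled converters
(`MultiConverterSystem.exists_unitary_freqResp_devicesT`). Where the gain condition holds,
`‖H(jω)‖ ‖G(jω)‖ < 1` (`det_one_add_ne_zero_of_gain`); at a pole of the network the bound on `H(jω)`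
is obtained from neighbouring frequencies by continuity (`exists_gain_bound_of_lt_sigmaMinAt`).
Where the phase condition holds, the phases of `G(jω)` and the negatives of those of `H(jω)` have
mutual distances less than `π`, so they lie in a common open half plane. If `v` were in the kernel
of `I + τ H G` and `w = G v`, then `conj (v* G v) = w* v = -τ w* H w`, and the two sides would lie
in opposite half planes (`det_one_add_ne_zero_of_phase`).

*In the interior* the argument principle is avoided by a maximum modulus argument. By compactness
the determinants `f_τ` are bounded below by some `m > 0` on the imaginary axis, uniformly in `τ`. If
`f_τ` has a stable inverse, the Phragmén-Lindelöf principle extends this bound to the right half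
plane; a parameter `τ'` with `|f_τ' - f_τ| < m` on the axis satisfies the same inequality in the
half plane, so `f_τ'` has no zero there either (`TF.inv_mem_of_near`). Finitely many steps lead from
`f_0 = 1` to `f_1` (`TF.inv_mem_of_homotopy`). Then Cramer's rule shows that all closed-loop
functions are stable (`feedbackStable_of_det_ne_zero`).

Undoing the rescaling is algebra: although `F_ε` may be unstable, only its inverse enters the
closed-loop functions of the original loop (`feedbackNoUnstablePole_of_rescaled`).
-/

/-! ### Evaluation of rational functions -/

namespace TF

open Polynomial

theorem num_mul_eq (f : TF) {p q : ℝ[X]} (hq : q ≠ 0)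
    (h : f = algebraMap _ _ p / algebraMap _ _ q) : f.num * q = p * f.denom :=
  (RatFunc.num_mul_eq_mul_denom_iff hq).2 h

/-- Properness and the value at infinity can be read off any fraction `p / q` representing `f`, not
just the reduced one. -/
theorem top_of_eq_div (f : TF) {p q : ℝ[X]} (hq : q ≠ 0)
    (h : f = algebraMap _ _ p / algebraMap _ _ q) (hpq : p.natDegree ≤ q.natDegree) :
    f.Proper ∧ f.resp ⊤ = ((p.coeff q.natDegree / q.leadingCoeff : ℝ) : ℂ) := by
  have e := f.num_mul_eq hq h
  have hd := f.denom_ne_zero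
  rcases eq_or_ne p 0 with rfl | hp
  · have : f = 0 := by simpa using h
    subst this
    simp [TF.Proper, TF.resp]
  have hn : f.num ≠ 0 := by
    intro h0
    rw [h0, zero_mul] at e
    exact mul_ne_zero hp hd e.symm
  have hdeg := congrArg natDegree e
  rw [natDegree_mul hn hq, natDegree_mul hp hd] at hdeg
  have hP : f.num.natDegree ≤ f.denom.natDegree := by omega
  refine ⟨hP, ?_⟩
  have hc := congrArg (fun r => coeff r (f.denom.natDegree + q.natDegree)) e
  rw [coeff_mul_add_eq_of_natDegree_le hP le_rfl, add_comm,
    coeff_mul_add_eq_of_natDegree_le hpq le_rfl] at hc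
  simp only [TF.resp, if_true]
  congr 1
  rw [div_eq_div_iff (leadingCoeff_ne_zero.2 hd) (leadingCoeff_ne_zero.2 hq)]
  exact hc

theorem regularAt_top {f : TF} : f.RegularAt ⊤ ↔ f.Proper := by simp [RegularAt]

theorem regularAt_of_ne_top {f : TF} {ω : ℝ≥0∞} (h : ω ≠ ⊤) :
    f.RegularAt ω ↔ eval₂ (algebraMap ℝ ℂ) (Complex.I * (ω.toReal : ℂ)) f.denom ≠ 0 := by
  simp [RegularAt, h, aeval_def]

theorem resp_of_ne_top (f : TF) {ω : ℝ≥0∞} (h : ω ≠ ⊤) :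
    f.resp ω = f.eval (algebraMap ℝ ℂ) (Complex.I * (ω.toReal : ℂ)) := by
  simp [resp, h]

theorem eval₂_ne_zero_of_dvd {p q : ℝ[X]} {s : ℂ} (h : p ∣ q)
    (hq : eval₂ (algebraMap ℝ ℂ) s q ≠ 0) : eval₂ (algebraMap ℝ ℂ) s p ≠ 0 := by
  obtain ⟨r, rfl⟩ := h
  rw [eval₂_mul] at hq
  exact left_ne_zero_of_mul hq

theorem regularAt_mul {f g : TF} {ω : ℝ≥0∞} (hf : f.RegularAt ω) (hg : g.RegularAt ω) :
    (f * g).RegularAt ω ∧ (f * g).resp ω = f.resp ω * g.resp ω := by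
  by_cases h : ω = ⊤
  · subst h
    rw [regularAt_top] at *
    have := (f * g).top_of_eq_div (p := f.num * g.num) (q := f.denom * g.denom)
      (mul_ne_zero f.denom_ne_zero g.denom_ne_zero)
      (by rw [map_mul, map_mul, ← div_mul_div_comm, f.num_div_denom, g.num_div_denom])
      (by
        rw [natDegree_mul f.denom_ne_zero g.denom_ne_zero]
        exact natDegree_mul_le.trans (add_le_add hf hg))
    refine ⟨this.1, ?_⟩
    rw [this.2, natDegree_mul f.denom_ne_zero g.denom_ne_zero,
      coeff_mul_add_eq_of_natDegree_le hf hg, leadingCoeff_mul, mul_div_mul_comm]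
    simp [resp]
  · rw [regularAt_of_ne_top h] at *
    refine ⟨eval₂_ne_zero_of_dvd (RatFunc.denom_mul_dvd f g) ?_, ?_⟩
    · rw [eval₂_mul]
      exact mul_ne_zero hf hg
    · simp only [resp_of_ne_top _ h]
      exact RatFunc.eval_mul _ _ hf hg

theorem regularAt_add {f g : TF} {ω : ℝ≥0∞} (hf : f.RegularAt ω) (hg : g.RegularAt ω) :
    (f + g).RegularAt ω ∧ (f + g).resp ω = f.resp ω + g.resp ω := by
  by_cases h : ω = ⊤
  · subst h
    rw [regularAt_top] at *
    have hfa : algebraMap ℝ[X] TF f.denom ≠ 0 := RatFunc.algebraMap_ne_zero f.denom_ne_zero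
    have hga : algebraMap ℝ[X] TF g.denom ≠ 0 := RatFunc.algebraMap_ne_zero g.denom_ne_zero
    have := (f + g).top_of_eq_div (p := f.num * g.denom + f.denom * g.num)
      (q := f.denom * g.denom) (mul_ne_zero f.denom_ne_zero g.denom_ne_zero)
      (by
        rw [map_mul, map_add, map_mul, map_mul, ← div_add_div _ _ hfa hga, f.num_div_denom,
          g.num_div_denom])
      (by
        rw [natDegree_mul f.denom_ne_zero g.denom_ne_zero]
        exact (natDegree_add_le _ _).trans (max_le
          (natDegree_mul_le.trans (add_le_add hf le_rfl))
          (natDegree_mul_le.trans (add_le_add le_rfl hg))))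
    refine ⟨this.1, ?_⟩
    have h1 : f.denom.leadingCoeff ≠ 0 := leadingCoeff_ne_zero.2 f.denom_ne_zero
    have h2 : g.denom.leadingCoeff ≠ 0 := leadingCoeff_ne_zero.2 g.denom_ne_zero
    rw [this.2, natDegree_mul f.denom_ne_zero g.denom_ne_zero, coeff_add,
      coeff_mul_add_eq_of_natDegree_le hf le_rfl, coeff_mul_add_eq_of_natDegree_le le_rfl hg,
      leadingCoeff_mul]
    simp only [resp, if_true, coeff_natDegree]
    rw [← Complex.ofReal_add, div_add_div _ _ h1 h2]
  · rw [regularAt_of_ne_top h] at *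
    refine ⟨eval₂_ne_zero_of_dvd (RatFunc.denom_add_dvd f g) ?_, ?_⟩
    · rw [eval₂_mul]
      exact mul_ne_zero hf hg
    · simp only [resp_of_ne_top _ h]
      exact RatFunc.eval_add _ _ hf hg

theorem regularAt_C (c : ℝ) (ω : ℝ≥0∞) :
    RegularAt (RatFunc.C c : TF) ω ∧ resp (RatFunc.C c : TF) ω = c := by
  by_cases h : ω = ⊤
  · subst h
    rw [regularAt_top]
    simp [Proper, resp]
  · rw [regularAt_of_ne_top h, resp_of_ne_top _ h]
    simp

/-- The ring of rational functions without a pole at `jω`. -/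
noncomputable def regularSubring (ω : ℝ≥0∞) : Subring TF where
  carrier := {f | f.RegularAt ω}
  mul_mem' hf hg := (regularAt_mul hf hg).1
  add_mem' hf hg := (regularAt_add hf hg).1
  one_mem' := by simpa using (regularAt_C 1 ω).1
  zero_mem' := by simpa using (regularAt_C 0 ω).1
  neg_mem' {f} hf := by
    have := (regularAt_mul (regularAt_C (-1) ω).1 hf).1
    simpa using this

/-- Evaluation at `jω` as a ring homomorphism on the functions without a pole there. -/
noncomputable def respHom (ω : ℝ≥0∞) : regularSubring ω →+* ℂ where
  toFun f := (f : TF).resp ω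
  map_mul' f g := (regularAt_mul f.2 g.2).2
  map_add' f g := (regularAt_add f.2 g.2).2
  map_one' := by simpa using (regularAt_C 1 ω).2
  map_zero' := by simpa using (regularAt_C 0 ω).2

/-- The ring of rational functions, proper or not, without poles in the closed right half plane. -/
noncomputable def unstablePoleFreeSubring : Subring TF where
  carrier := {f | f.NoUnstablePole}
  mul_mem' {f g} hf hg s hs := by
    refine eval₂_ne_zero_of_dvd (RatFunc.denom_mul_dvd f g) ?_
    rw [eval₂_mul]
    exact mul_ne_zero (hf s hs) (hg s hs)
  add_mem' {f g} hf hg s hs := by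
    refine eval₂_ne_zero_of_dvd (RatFunc.denom_add_dvd f g) ?_
    rw [eval₂_mul]
    exact mul_ne_zero (hf s hs) (hg s hs)
  one_mem' := by simp [NoUnstablePole]
  zero_mem' := by simp [NoUnstablePole]
  neg_mem' {f} hf s hs := by
    refine eval₂_ne_zero_of_dvd ((RatFunc.denom_dvd f.denom_ne_zero).2 ⟨-f.num, ?_⟩) (hf s hs)
    rw [map_neg, neg_div, f.num_div_denom]

/-- The ring of proper rational functions without poles in the closed right half plane. -/
noncomputable def stableSubring : Subring TF := regularSubring ⊤ ⊓ unstablePoleFreeSubring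

theorem mem_stableSubring {f : TF} : f ∈ stableSubring ↔ f.Proper ∧ f.NoUnstablePole :=
  and_congr regularAt_top Iff.rfl

theorem C_mem_stableSubring (c : ℝ) : (RatFunc.C c : TF) ∈ stableSubring := by
  rw [mem_stableSubring]
  simp [Proper, NoUnstablePole]

theorem regularAt_of_mem {f : TF} (hf : f ∈ stableSubring) (ω : ℝ≥0∞) : f.RegularAt ω := by
  rw [mem_stableSubring] at hf
  by_cases h : ω = ⊤
  · subst h
    exact regularAt_top.2 hf.1
  · rw [regularAt_of_ne_top h]
    exact hf.2 _ (by simp)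

/-- A stable function with no zero in the closed right half plane and at infinity is a unit. -/
theorem inv_mem_stableSubring {f : TF} (hf : f ∈ stableSubring)
    (h0 : ∀ s : ℂ, 0 ≤ s.re → f.eval (algebraMap ℝ ℂ) s ≠ 0) (htop : f.resp ⊤ ≠ 0) :
    f⁻¹ ∈ stableSubring := by
  rw [mem_stableSubring] at *
  have hf0 : f ≠ 0 := by
    rintro rfl
    simp [resp] at htop
  have hn : f.num ≠ 0 := RatFunc.num_ne_zero hf0
  have hlead : f.num.coeff f.denom.natDegree ≠ 0 := by
    intro h
    simp [resp, h] at htop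
  refine ⟨((f⁻¹).top_of_eq_div (p := f.denom) (q := f.num) hn ?_
    (le_natDegree_of_ne_zero hlead)).1, fun s hs => ?_⟩
  · conv_lhs => rw [← f.num_div_denom]
    rw [inv_div]
  · refine eval₂_ne_zero_of_dvd (RatFunc.denom_inv_dvd hf0) fun h => h0 s hs ?_
    rw [RatFunc.eval, h, zero_div]

/-! ### Continuity of the frequency response -/

open Filter Bornology

theorem tendsto_eval₂_div_pow {p : ℝ[X]} {n : ℕ} (hp : p.natDegree ≤ n) :
    Tendsto (fun s : ℂ => eval₂ (algebraMap ℝ ℂ) s p / s ^ n) (cobounded ℂ)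
      (𝓝 (p.coeff n : ℂ)) := by
  have h1 : Tendsto (fun s : ℂ => eval₂ (algebraMap ℝ ℂ) s⁻¹ (reflect n p)) (cobounded ℂ)
      (𝓝 (eval₂ (algebraMap ℝ ℂ) 0 (reflect n p))) := by
    have hc : Continuous fun s : ℂ => eval₂ (algebraMap ℝ ℂ) s (reflect n p) := by
      simpa [aeval_def] using (reflect n p).continuous_aeval (A := ℂ)
    exact (hc.tendsto 0).comp tendsto_inv₀_cobounded
  rw [eval₂_at_zero, coeff_reflect, revAt_le (Nat.zero_le n), Nat.sub_zero] at h1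
  refine h1.congr' ?_
  filter_upwards [eventually_ne_cobounded (0 : ℂ)] with s hs
  have : Invertible s := invertibleOfNonzero hs
  have h := eval₂_reflect_mul_pow (algebraMap ℝ ℂ) s n p hp
  rw [invOf_eq_inv] at h
  rw [← h, mul_div_cancel_right₀ _ (pow_ne_zero n hs)]

theorem tendsto_eval_cobounded {f : TF} (hf : f.Proper) :
    Tendsto (fun s : ℂ => f.eval (algebraMap ℝ ℂ) s) (cobounded ℂ) (𝓝 (f.resp ⊤)) := by
  have h := (tendsto_eval₂_div_pow hf).div (tendsto_eval₂_div_pow (le_refl f.denom.natDegree))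
    (by simpa using f.denom_ne_zero)
  have e : f.resp ⊤ = (f.num.coeff f.denom.natDegree : ℂ) / f.denom.coeff f.denom.natDegree := by
    simp [resp]
  rw [e]
  refine h.congr' ?_
  filter_upwards [eventually_ne_cobounded (0 : ℂ)] with s hs
  simp only [Pi.div_apply, RatFunc.eval]
  exact div_div_div_cancel_right₀ (pow_ne_zero _ hs) _ _

theorem tendsto_I_mul_toReal_cobounded :
    Tendsto (fun t : ℝ≥0∞ => Complex.I * (t.toReal : ℂ)) (𝓝[≠] ⊤) (cobounded ℂ) := by
  rw [← tendsto_norm_atTop_iff_cobounded, tendsto_atTop]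
  intro r
  filter_upwards [self_mem_nhdsWithin, mem_nhdsWithin_of_mem_nhds
    (lt_mem_nhds (ENNReal.ofReal_lt_top (r := r)))] with t ht hr
  simp only [norm_mul, Complex.norm_I, one_mul, Complex.norm_real, Real.norm_eq_abs]
  exact ((ENNReal.ofReal_le_iff_le_toReal ht).1 hr.le).trans (le_abs_self _)

theorem continuousAt_resp {f : TF} {ω : ℝ≥0∞} (hf : f.RegularAt ω) : ContinuousAt f.resp ω := by
  by_cases h : ω = ⊤
  · subst h
    rw [continuousAt_iff_punctured_nhds]
    refine ((tendsto_eval_cobounded (regularAt_top.1 hf)).comp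
      tendsto_I_mul_toReal_cobounded).congr' ?_
    filter_upwards [self_mem_nhdsWithin] with t ht
    exact (resp_of_ne_top f ht).symm
  · have hc : ∀ p : ℝ[X], ContinuousAt
        (fun t : ℝ≥0∞ => eval₂ (algebraMap ℝ ℂ) (Complex.I * (t.toReal : ℂ)) p) ω := by
      intro p
      have h1 : Continuous fun s : ℂ => eval₂ (algebraMap ℝ ℂ) s p := by
        simpa [aeval_def] using p.continuous_aeval (A := ℂ)
      refine h1.continuousAt.comp (continuousAt_const.mul ?_)
      exact Complex.continuous_ofReal.continuousAt.comp (ENNReal.continuousAt_toReal h)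
    rw [regularAt_of_ne_top h] at hf
    refine ((hc f.num).div (hc f.denom) hf).congr ?_
    filter_upwards [isOpen_ne.mem_nhds h] with t ht
    exact (resp_of_ne_top f ht).symm

/-- The poles of a rational function are isolated, also at infinity. -/
theorem eventually_regularAt (f : TF) (ω : ℝ≥0∞) : ∀ᶠ t in 𝓝[≠] ω, f.RegularAt t := by
  have hroots : {s : ℂ | (f.denom.map (algebraMap ℝ ℂ)).IsRoot s}.Finite :=
    finite_setOfPred_isRoot (by simpa [Polynomial.map_eq_zero] using f.denom_ne_zero)
  have hfin := ((hroots.image fun s => ENNReal.ofReal s.im).insert ⊤).sdiff (t := {ω})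
  filter_upwards [self_mem_nhdsWithin, mem_nhdsWithin_of_mem_nhds
    (hfin.isClosed.isOpen_compl.mem_nhds (x := ω) (by simp))] with t ht h
  by_contra hr
  refine h ⟨?_, ht⟩
  by_cases htop : t = ⊤
  · exact Or.inl htop
  · rw [regularAt_of_ne_top htop, not_not] at hr
    refine Or.inr ⟨Complex.I * (t.toReal : ℂ), ?_, ?_⟩
    · simpa [IsRoot, eval_map] using hr
    · simp [ENNReal.ofReal_toReal htop]

end TF

/-! ### The maximum modulus principle and the homotopy argument -/

namespace TF

open Polynomial Filter Bornology

theorem eval_conj (f : TF) (s : ℂ) :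
    f.eval (algebraMap ℝ ℂ) (starRingEnd ℂ s) = starRingEnd ℂ (f.eval (algebraMap ℝ ℂ) s) := by
  simp only [RatFunc.eval, ← aeval_def, aeval_conj, map_div₀]

theorem norm_eval_imaginary_axis_le {f : TF} {M : ℝ} (h : ∀ ω, ‖f.resp ω‖ ≤ M) (x : ℝ) :
    ‖f.eval (algebraMap ℝ ℂ) (x * Complex.I)‖ ≤ M := by
  have key : ∀ y : ℝ, 0 ≤ y → ‖f.eval (algebraMap ℝ ℂ) (y * Complex.I)‖ ≤ M := by
    intro y hy
    have := h (ENNReal.ofReal y)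
    rwa [resp_of_ne_top _ ENNReal.ofReal_ne_top, ENNReal.toReal_ofReal hy, mul_comm] at this
  rcases le_total 0 x with hx | hx
  · exact key x hx
  · have := key (-x) (by linarith)
    rwa [← Complex.norm_conj, ← eval_conj, map_mul, Complex.conj_ofReal, Complex.conj_I,
      Complex.ofReal_neg, neg_mul_neg] at this

/-- Maximum modulus principle: a stable transfer function is bounded on the closed right half plane
by its supremum over the nonnegative frequencies. -/
theorem norm_eval_le {f : TF} (hf : f ∈ stableSubring) {M : ℝ} (h : ∀ ω, ‖f.resp ω‖ ≤ M) {s : ℂ}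
    (hs : 0 ≤ s.re) : ‖f.eval (algebraMap ℝ ℂ) s‖ ≤ M := by
  rw [mem_stableSubring] at hf
  have hlim := tendsto_eval_cobounded hf.1
  refine PhragmenLindelof.right_half_plane_of_bounded_on_real
    (f := fun s => f.eval (algebraMap ℝ ℂ) s) ?_ ⟨0, two_pos, 0, ?_⟩ ?_
    (norm_eval_imaginary_axis_le h) hs
  · refine DifferentiableOn.diffContOnCl fun z hz => ?_
    rw [Complex.closure_setOfPred_lt_re] at hz
    have hp : ∀ p : ℝ[X], Differentiable ℂ fun s : ℂ => eval₂ (algebraMap ℝ ℂ) s p := fun p => by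
      simpa [eval_map] using (p.map (algebraMap ℝ ℂ)).differentiable
    exact ((hp _ z).div (hp _ z) (hf.2 z hz)).differentiableWithinAt
  · simp only [zero_mul, Real.exp_zero]
    exact hlim.isBigO_one ℝ |>.mono inf_le_left
  · have : Tendsto (fun x : ℝ => (x : ℂ)) atTop (cobounded ℂ) := by
      rw [← tendsto_norm_atTop_iff_cobounded]
      simpa using tendsto_abs_atTop_atTop
    exact (hlim.comp this).norm.isBoundedUnder_le

theorem eval_mul_of_mem {f g : TF} (hf : f ∈ stableSubring) (hg : g ∈ stableSubring) {s : ℂ}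
    (hs : 0 ≤ s.re) : (f * g).eval (algebraMap ℝ ℂ) s =
      f.eval (algebraMap ℝ ℂ) s * g.eval (algebraMap ℝ ℂ) s :=
  RatFunc.eval_mul _ _ ((mem_stableSubring.1 hf).2 s hs) ((mem_stableSubring.1 hg).2 s hs)

theorem eval_add_of_mem {f g : TF} (hf : f ∈ stableSubring) (hg : g ∈ stableSubring) {s : ℂ}
    (hs : 0 ≤ s.re) : (f + g).eval (algebraMap ℝ ℂ) s =
      f.eval (algebraMap ℝ ℂ) s + g.eval (algebraMap ℝ ℂ) s :=
  RatFunc.eval_add _ _ ((mem_stableSubring.1 hf).2 s hs) ((mem_stableSubring.1 hg).2 s hs)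

/-- A stable function is a unit among the stable functions as soon as it is uniformly close on the
imaginary axis to such a unit. -/
theorem inv_mem_of_near {f g : TF} (hf : f ∈ stableSubring) (hf' : f⁻¹ ∈ stableSubring)
    (hg : g ∈ stableSubring) {m η : ℝ} (hη : η < m) (hm : 0 < m) (hfm : ∀ ω, m ≤ ‖f.resp ω‖)
    (hgm : ∀ ω, m ≤ ‖g.resp ω‖) (hfg : ∀ ω, ‖g.resp ω - f.resp ω‖ ≤ η) : g⁻¹ ∈ stableSubring := by
  have hf0 : f ≠ 0 := by
    rintro rfl
    have := hfm ⊤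
    simp [resp] at this
    linarith
  have hd : g - f ∈ stableSubring := sub_mem hg hf
  refine inv_mem_stableSubring hg (fun s hs h0 => ?_) fun h0 => ?_
  -- At a zero `s` of `g`, the bounds `|1 / f| ≤ 1 / m` and `|g - f| ≤ η` give `m ≤ |f s| ≤ η`.
  · have h1 : ‖(f⁻¹).eval (algebraMap ℝ ℂ) s‖ ≤ m⁻¹ := by
      refine norm_eval_le hf' (fun ω => ?_) hs
      have h := (regularAt_mul (regularAt_of_mem hf ω) (regularAt_of_mem hf' ω)).2
      rw [mul_inv_cancel₀ hf0, ← map_one RatFunc.C, (regularAt_C 1 ω).2, Complex.ofReal_one] at h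
      rw [eq_inv_of_mul_eq_one_right h.symm, norm_inv]
      exact inv_anti₀ hm (hfm ω)
    have h2 : ‖(g - f).eval (algebraMap ℝ ℂ) s‖ ≤ η := by
      refine norm_eval_le hd (fun ω => ?_) hs
      have h := (regularAt_add (regularAt_of_mem hd ω) (regularAt_of_mem hf ω)).2
      rw [sub_add_cancel] at h
      rw [eq_sub_of_add_eq h.symm]
      exact hfg ω
    have h3 := eval_add_of_mem hd hf hs
    rw [sub_add_cancel, h0] at h3
    have h4 := eval_mul_of_mem hf hf' hs
    rw [mul_inv_cancel₀ hf0, RatFunc.eval_one, eq_neg_of_add_eq_zero_right h3.symm] at h4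
    have h5 := congrArg norm h4
    rw [norm_one, norm_mul, norm_neg] at h5
    have h6 : (1 : ℝ) ≤ η * m⁻¹ := h5 ▸ mul_le_mul h2 h1 (norm_nonneg _) ((norm_nonneg _).trans h2)
    rw [← div_eq_mul_inv, one_le_div hm] at h6
    linarith
  · have := hgm ⊤
    rw [h0, norm_zero] at this
    linarith

/-- Homotopy invariance of stability: if a path of stable functions starts at `1` and has no zero
on the imaginary axis and at infinity, then its endpoint is a unit among the stable functions. -/
theorem inv_mem_of_homotopy (c : ℝ → TF) (hc : ∀ τ, c τ ∈ stableSubring)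
    (hcont : Continuous fun p : ℝ × ℝ≥0∞ => (c p.1).resp p.2) (h0 : c 0 = 1)
    (hne : ∀ τ ∈ Set.Icc (0 : ℝ) 1, ∀ ω, (c τ).resp ω ≠ 0) : (c 1)⁻¹ ∈ stableSubring := by
  have hK : IsCompact (Set.Icc (0 : ℝ) 1 ×ˢ (Set.univ : Set ℝ≥0∞)) :=
    isCompact_Icc.prod isCompact_univ
  obtain ⟨p, hp, hmin⟩ := hK.exists_isMinOn ⟨(0, 0), by simp⟩ hcont.norm.continuousOn
  have hm : 0 < ‖(c p.1).resp p.2‖ := norm_pos_iff.2 (hne _ hp.1 _)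
  set m := ‖(c p.1).resp p.2‖
  have hlow : ∀ τ ∈ Set.Icc (0 : ℝ) 1, ∀ ω, m ≤ ‖(c τ).resp ω‖ := fun τ hτ ω =>
    hmin (show (τ, ω) ∈ Set.Icc (0 : ℝ) 1 ×ˢ Set.univ from ⟨hτ, trivial⟩)
  -- The responses form a path in the space of continuous functions on the compact frequency axis.
  let F : C(ℝ, C(ℝ≥0∞, ℂ)) := ContinuousMap.curry ⟨_, hcont⟩
  obtain ⟨δ, hδ, hF⟩ := Metric.uniformContinuousOn_iff.1
    (isCompact_Icc.uniformContinuousOn_of_continuous F.continuous.continuousOn) m hm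
  obtain ⟨n, hn⟩ := exists_nat_one_div_lt hδ
  have hn0 : (0 : ℝ) < n + 1 := by positivity
  have hmem : ∀ k : ℕ, k ≤ n + 1 → (k / (n + 1) : ℝ) ∈ Set.Icc (0 : ℝ) 1 := fun k hk =>
    ⟨by positivity, (div_le_one hn0).2 (by exact_mod_cast hk)⟩
  have step : ∀ k : ℕ, k ≤ n + 1 → (c (k / (n + 1)))⁻¹ ∈ stableSubring := by
    intro k
    induction k with
    | zero => intro _; simp [h0, one_mem]
    | succ k ih =>
      intro hk
      have h1 := hmem k (by omega)
      have h2 := hmem (k + 1) hk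
      refine inv_mem_of_near (hc _) (ih (by omega)) (hc _) (hF _ h2 _ h1 ?_) hm (hlow _ h1)
        (hlow _ h2) fun ω => ?_
      · rw [Real.dist_eq, ← sub_div, Nat.cast_succ, add_sub_cancel_left, abs_of_pos (by positivity)]
        exact hn
      · rw [← dist_eq_norm]
        exact ContinuousMap.dist_apply_le_dist (f := F _) (g := F _) ω
  have := step (n + 1) le_rfl
  rwa [Nat.cast_succ, div_self hn0.ne'] at this

end TF

/-! ### Complex matrices: gains and phases -/

section ComplexMatrices

open WithLp

variable {n : Type*} [Fintype n] [DecidableEq n]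

/-- `‖T x‖²` in the coordinates of `x` with respect to right singular vectors of `T`. -/
theorem LinearMap.norm_sq_apply_eq_sum {E F : Type*} [NormedAddCommGroup E]
    [InnerProductSpace ℂ E] [FiniteDimensional ℂ E] [NormedAddCommGroup F] [InnerProductSpace ℂ F]
    [FiniteDimensional ℂ F] (T : E →ₗ[ℂ] F) {m : ℕ} (hm : Module.finrank ℂ E = m) (x : E) :
    ‖T x‖ ^ 2 = ∑ i : Fin m, T.singularValues i ^ 2 *
      ‖(T.isSymmetric_adjoint_comp_self.eigenvectorBasis hm).repr x i‖ ^ 2 := by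
  set b := T.isSymmetric_adjoint_comp_self.eigenvectorBasis hm
  have h1 : (‖T x‖ ^ 2 : ℝ) = RCLike.re (inner ℂ x ((T.adjoint ∘ₗ T) x)) := by
    rw [LinearMap.comp_apply, LinearMap.adjoint_inner_right, inner_self_eq_norm_sq]
  rw [h1, ← b.sum_inner_mul_inner, map_sum]
  refine Finset.sum_congr rfl fun i _ => ?_
  rw [← b.repr_apply_apply ((T.adjoint ∘ₗ T) x),
    T.isSymmetric_adjoint_comp_self.eigenvectorBasis_apply_self_apply hm,
    T.sq_singularValues_fin hm, ← inner_conj_symm, ← b.repr_apply_apply, mul_left_comm,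
    RCLike.re_ofReal_mul, RCLike.conj_mul]
  norm_cast

theorem norm_mulVec_le_sigmaMax (A : Matrix n n ℂ) (x : n → ℂ) :
    ‖toLp 2 (A *ᵥ x)‖ ≤ sigmaMax A * ‖toLp 2 x‖ := by
  set T := Matrix.toEuclideanLin A
  refine le_of_sq_le_sq ?_ (mul_nonneg (T.singularValues_nonneg 0) (norm_nonneg _))
  have h : toLp 2 (A *ᵥ x) = T (toLp 2 x) := rfl
  rw [h, T.norm_sq_apply_eq_sum finrank_euclideanSpace, mul_pow,
    ← (T.isSymmetric_adjoint_comp_self.eigenvectorBasis finrank_euclideanSpace).repr.norm_map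
      (toLp 2 x), EuclideanSpace.norm_sq_eq, Finset.mul_sum]
  gcongr
  · exact T.singularValues_nonneg _
  · exact T.singularValues_antitone (Nat.zero_le _)

theorem sigmaMin_mul_norm_le (A : Matrix n n ℂ) (x : n → ℂ) :
    sigmaMin A * ‖toLp 2 x‖ ≤ ‖toLp 2 (A *ᵥ x)‖ := by
  set T := Matrix.toEuclideanLin A
  refine le_of_sq_le_sq ?_ (norm_nonneg _)
  have h : toLp 2 (A *ᵥ x) = T (toLp 2 x) := rfl
  rw [h, T.norm_sq_apply_eq_sum finrank_euclideanSpace, mul_pow,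
    ← (T.isSymmetric_adjoint_comp_self.eigenvectorBasis finrank_euclideanSpace).repr.norm_map
      (toLp 2 x), EuclideanSpace.norm_sq_eq, Finset.mul_sum]
  gcongr with i
  · exact T.singularValues_nonneg _
  · exact T.singularValues_antitone (by omega)

/-- Small gain: if `A` is bounded by `a`, `B` by `1 / c` and `a < c`, the loop is nonsingular. -/
theorem det_one_add_ne_zero_of_gain {A B : Matrix n n ℂ} {a c : ℝ} (ha : 0 ≤ a) (hac : a < c)
    (hA : ∀ x, ‖toLp 2 (A *ᵥ x)‖ ≤ a * ‖toLp 2 x‖)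
    (hB : ∀ x, c * ‖toLp 2 (B *ᵥ x)‖ ≤ ‖toLp 2 x‖) {τ : ℝ} (hτ : τ ∈ Set.Icc (0 : ℝ) 1) :
    (1 + (τ : ℂ) • (B * A)).det ≠ 0 := by
  intro h
  obtain ⟨v, hv0, hv⟩ := Matrix.exists_mulVec_eq_zero_iff.2 h
  rw [Matrix.add_mulVec, Matrix.one_mulVec, Matrix.smul_mulVec, ← Matrix.mulVec_mulVec] at hv
  have h1 : ‖toLp 2 v‖ = τ * ‖toLp 2 (B *ᵥ (A *ᵥ v))‖ := by
    have := congrArg (fun z => ‖toLp 2 z‖) (eq_neg_of_add_eq_zero_left hv)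
    rwa [toLp_neg, norm_neg, toLp_smul, norm_smul, Complex.norm_real,
      Real.norm_of_nonneg hτ.1] at this
  have hpos : 0 < ‖toLp 2 v‖ := by
    rw [norm_pos_iff]
    simpa using hv0
  have h2 := (hB (A *ᵥ v)).trans (hA v)
  have h3 : τ * ‖toLp 2 (B *ᵥ (A *ᵥ v))‖ ≤ ‖toLp 2 (B *ᵥ (A *ᵥ v))‖ :=
    mul_le_of_le_one_left (norm_nonneg _) hτ.2
  have h4 := mul_le_mul_of_nonneg_left (h1.le.trans h3) (ha.trans hac.le)
  nlinarith

/-- Finitely many angles with mutual distances less than `π` lie in an open half plane. -/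
theorem exists_cos_sub_pos {ι : Type*} [Finite ι] [Nonempty ι] (χ : ι → ℝ)
    (h : ∀ k l, χ k - χ l < Real.pi) : ∃ γ, ∀ k, 0 < Real.cos (χ k - γ) := by
  obtain ⟨k₁, h₁⟩ := Finite.exists_max χ
  obtain ⟨k₀, h₀⟩ := Finite.exists_min χ
  refine ⟨(χ k₁ + χ k₀) / 2, fun k => Real.cos_pos_of_mem_Ioo ⟨?_, ?_⟩⟩ <;>
    linarith [h₁ k, h₀ k, h k₁ k₀]

/-- The quadratic form of a matrix with phases `φ` lies in every open half plane that contains all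
the directions `e^{jφ_k}`. -/
theorem re_quadraticForm_pos {T : Matrix n n ℂ} (hT : IsUnit T.det) {φ : n → ℝ} {γ : ℝ}
    (h : ∀ k, 0 < Real.cos (φ k - γ)) {x : n → ℂ} (hx : x ≠ 0) :
    0 < (Complex.exp (-γ * Complex.I) * (star x ⬝ᵥ
      ((Tᴴ * Matrix.diagonal (fun k => Complex.exp ((φ k : ℂ) * Complex.I)) * T) *ᵥ x))).re := by
  have h1 : star x ⬝ᵥ
      ((Tᴴ * Matrix.diagonal (fun k => Complex.exp ((φ k : ℂ) * Complex.I)) * T) *ᵥ x) =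
      ∑ k, Complex.exp ((φ k : ℂ) * Complex.I) * (Complex.normSq ((T *ᵥ x) k) : ℂ) := by
    rw [mul_assoc, ← Matrix.mulVec_mulVec, Matrix.dotProduct_mulVec, ← Matrix.star_mulVec,
      ← Matrix.mulVec_mulVec]
    refine Finset.sum_congr rfl fun k _ => ?_
    rw [Matrix.mulVec_diagonal, Pi.star_apply, Complex.normSq_eq_conj_mul_self, ← starRingEnd_apply]
    ring
  have h2 : (Complex.exp (-γ * Complex.I) * (star x ⬝ᵥ
      ((Tᴴ * Matrix.diagonal (fun k => Complex.exp ((φ k : ℂ) * Complex.I)) * T) *ᵥ x))).re =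
      ∑ k, Real.cos (φ k - γ) * Complex.normSq ((T *ᵥ x) k) := by
    rw [h1, Finset.mul_sum, Complex.re_sum]
    refine Finset.sum_congr rfl fun k _ => ?_
    rw [← mul_assoc, ← Complex.exp_add, ← add_mul, Complex.re_mul_ofReal]
    congr 1
    rw [show (-γ + φ k : ℂ) = ((φ k - γ : ℝ) : ℂ) by push_cast; ring, Complex.exp_ofReal_mul_I_re]
  have h3 : T *ᵥ x ≠ 0 := fun h0 => hx
    (Matrix.mulVec_injective_of_isUnit ((Matrix.isUnit_iff_isUnit_det T).2 hT) (by simpa using h0))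
  obtain ⟨k, hk⟩ := Function.ne_iff.1 h3
  rw [h2]
  exact Finset.sum_pos' (fun k _ => mul_nonneg (h k).le (Complex.normSq_nonneg _))
    ⟨k, Finset.mem_univ _, mul_pos (h k) (Complex.normSq_pos.2 hk)⟩

/-- Small phase: the loop is nonsingular if the phases of `A` and the negatives of the phases of `B`
lie in a common open half plane. -/
theorem det_one_add_ne_zero_of_phase {A B S T : Matrix n n ℂ} (hS : IsUnit S.det)
    (hT : IsUnit T.det) {φ ψ : n → ℝ}
    (hA : A = Sᴴ * Matrix.diagonal (fun k => Complex.exp ((φ k : ℂ) * Complex.I)) * S)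
    (hB : B = Tᴴ * Matrix.diagonal (fun k => Complex.exp ((ψ k : ℂ) * Complex.I)) * T)
    {γ : ℝ} (hφ : ∀ k, 0 < Real.cos (φ k - γ)) (hψ : ∀ k, 0 < Real.cos (-ψ k - γ))
    {τ : ℝ} (hτ : 0 ≤ τ) : (1 + (τ : ℂ) • (B * A)).det ≠ 0 := by
  intro h
  obtain ⟨v, hv0, hv⟩ := Matrix.exists_mulVec_eq_zero_iff.2 h
  rw [Matrix.add_mulVec, Matrix.one_mulVec, Matrix.smul_mulVec, ← Matrix.mulVec_mulVec] at hv
  set w := A *ᵥ v with hw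
  have h1 : 0 < (Complex.exp (-γ * Complex.I) * (star v ⬝ᵥ w)).re := by
    rw [hw, hA]
    exact re_quadraticForm_pos hS hφ hv0
  have h2 : 0 ≤ (Complex.exp (γ * Complex.I) * (star w ⬝ᵥ (B *ᵥ w))).re := by
    rcases eq_or_ne w 0 with h0 | h0
    · simp [h0]
    · have := re_quadraticForm_pos (γ := -γ) hT (φ := ψ)
        (fun k => by rw [← Real.cos_neg]; convert! hψ k using 2; ring) h0
      rw [Complex.ofReal_neg, neg_neg, ← hB] at this
      exact this.le
  -- `w* v` is the conjugate of `v* A v`, and it equals `-τ w* B w` by the kernel equation.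
  have h3 : Complex.exp (γ * Complex.I) * (star w ⬝ᵥ v) =
      starRingEnd ℂ (Complex.exp (-γ * Complex.I) * (star v ⬝ᵥ w)) := by
    rw [map_mul, ← Complex.exp_conj, starRingEnd_apply (star v ⬝ᵥ w), Matrix.star_dotProduct]
    simp
  have h4 : star w ⬝ᵥ v = -((τ : ℂ) * (star w ⬝ᵥ (B *ᵥ w))) := by
    conv_lhs => rw [eq_neg_of_add_eq_zero_left hv]
    rw [dotProduct_neg, dotProduct_smul, smul_eq_mul]
  rw [← Complex.conj_re, ← h3, h4, mul_neg, mul_left_comm, Complex.neg_re,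
    Complex.re_ofReal_mul] at h1
  nlinarith

end ComplexMatrices

/-! ### Matrices of transfer functions -/

section TransferMatrices

open Filter

theorem Matrix.exists_map_subtype {R : Type*} [Ring R] (S : Subring R) {m n : Type*}
    {A : Matrix m n R} (h : ∀ i j, A i j ∈ S) : ∃ A' : Matrix m n S, A'.map S.subtype = A :=
  ⟨Matrix.of fun i j => ⟨A i j, h i j⟩, rfl⟩

theorem Matrix.mul_apply_mem {R : Type*} [Ring R] (S : Subring R) {l m n : Type*} [Fintype m]
    {A : Matrix l m R} {B : Matrix m n R} (hA : ∀ i j, A i j ∈ S) (hB : ∀ i j, B i j ∈ S) (i : l)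
    (j : n) : (A * B) i j ∈ S :=
  sum_mem fun k _ => mul_mem (hA i k) (hB k j)

variable {n : Type*} [Fintype n] [DecidableEq n]

theorem Matrix.one_apply_mem {n R : Type*} [DecidableEq n] [Ring R] (S : Subring R) (i j : n) :
    (1 : Matrix n n R) i j ∈ S := by
  rw [Matrix.one_apply]
  split_ifs
  exacts [one_mem S, zero_mem S]

theorem Matrix.det_mem {R : Type*} [CommRing R] (S : Subring R) {A : Matrix n n R}
    (h : ∀ i j, A i j ∈ S) : A.det ∈ S := by
  obtain ⟨A', rfl⟩ := Matrix.exists_map_subtype S h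
  exact (RingHom.map_det S.subtype A') ▸ A'.det.2

theorem Matrix.adjugate_apply_mem {R : Type*} [CommRing R] (S : Subring R) {A : Matrix n n R}
    (h : ∀ i j, A i j ∈ S) (i j : n) : A.adjugate i j ∈ S := by
  obtain ⟨A', rfl⟩ := Matrix.exists_map_subtype S h
  have := congrFun₂ (RingHom.map_adjugate S.subtype A') i j
  exact this ▸ (A'.adjugate i j).2

/-- A square matrix over a subring of a field whose determinant is a unit in the subring has its
inverse over the subring. -/
theorem Matrix.inv_apply_mem {F : Type*} [Field F] (S : Subring F) {A : Matrix n n F}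
    (h : ∀ i j, A i j ∈ S) (hdet : A.det⁻¹ ∈ S) (i j : n) : A⁻¹ i j ∈ S := by
  rw [Matrix.inv_def, Ring.inverse_eq_inv', Matrix.smul_apply, smul_eq_mul]
  exact mul_mem hdet (Matrix.adjugate_apply_mem S h i j)

theorem rhInf_iff_mem {l m : Type*} {A : Matrix l m TF} :
    RHInf A ↔ ∀ i j, A i j ∈ TF.stableSubring :=
  forall₂_congr fun _ _ => TF.mem_stableSubring.symm

theorem RHInf.regularAt {l m : Type*} {A : Matrix l m TF} (h : RHInf A) (ω : ℝ≥0∞) :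
    RegularAt A ω := fun i j => TF.regularAt_of_mem (rhInf_iff_mem.1 h i j) ω

theorem freqResp_mul {l m k : Type*} [Fintype m] {A : Matrix l m TF} {B : Matrix m k TF}
    {ω : ℝ≥0∞} (hA : RegularAt A ω) (hB : RegularAt B ω) :
    freqResp (A * B) ω = freqResp A ω * freqResp B ω := by
  obtain ⟨A', rfl⟩ := Matrix.exists_map_subtype (TF.regularSubring ω) hA
  obtain ⟨B', rfl⟩ := Matrix.exists_map_subtype (TF.regularSubring ω) hB
  have h := Matrix.map_mul (L := A') (M := B') (f := (TF.regularSubring ω).subtype)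
  rw [← h]
  exact Matrix.map_mul (f := TF.respHom ω)

theorem freqResp_one {n : Type*} [DecidableEq n] (ω : ℝ≥0∞) :
    freqResp (1 : Matrix n n TF) ω = 1 := by
  have h := Matrix.map_one (n := n) (TF.regularSubring ω).subtype (map_zero _) (map_one _)
  rw [← h]
  exact Matrix.map_one (TF.respHom ω) (map_zero _) (map_one _)

theorem resp_det_one_add_smul {A : Matrix n n TF} {ω : ℝ≥0∞} (hA : RegularAt A ω) (τ : ℝ) :
    (1 + RatFunc.C τ • A).det.resp ω = (1 + (τ : ℂ) • freqResp A ω).det := by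
  obtain ⟨A', rfl⟩ := Matrix.exists_map_subtype (TF.regularSubring ω) hA
  let c : TF.regularSubring ω := ⟨RatFunc.C τ, (TF.regularAt_C τ ω).1⟩
  have h1 : (1 + RatFunc.C τ • A'.map (TF.regularSubring ω).subtype) =
      (1 + c • A').map (TF.regularSubring ω).subtype := by
    ext i j
    by_cases hij : i = j <;> simp [c, hij]
  have h2 : (1 + (τ : ℂ) • freqResp (A'.map (TF.regularSubring ω).subtype) ω) =
      (1 + c • A').map (TF.respHom ω) := by
    have hc : TF.respHom ω c = (τ : ℂ) := (TF.regularAt_C τ ω).2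
    have hr : freqResp (A'.map (TF.regularSubring ω).subtype) ω = A'.map (TF.respHom ω) := rfl
    rw [hr, ← hc]
    ext i j
    by_cases hij : i = j <;> simp [hij]
  rw [h1, h2]
  have e1 := RingHom.map_det (TF.regularSubring ω).subtype (1 + c • A')
  have e2 := RingHom.map_det (TF.respHom ω) (1 + c • A')
  rw [RingHom.mapMatrix_apply] at e1 e2
  rw [← e1, ← e2]
  rfl

theorem continuousAt_freqResp {l m : Type*} {A : Matrix l m TF} {ω : ℝ≥0∞} (h : RegularAt A ω) :
    ContinuousAt (freqResp A) ω := by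
  refine continuousAt_pi.2 fun i => continuousAt_pi.2 fun j => ?_
  exact TF.continuousAt_resp (h i j)

/-- A stable loop transfer matrix `A` whose return difference `I + τA` stays nonsingular along the
imaginary axis and at infinity for all `τ ∈ [0, 1]` has a stable inverse return difference. -/
theorem det_one_add_inv_mem {A : Matrix n n TF} (hA : RHInf A)
    (hne : ∀ τ ∈ Set.Icc (0 : ℝ) 1, ∀ ω, (1 + (τ : ℂ) • freqResp A ω).det ≠ 0) :
    (1 + A).det⁻¹ ∈ TF.stableSubring := by
  have hreg := hA.regularAt
  rw [rhInf_iff_mem] at hA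
  have := TF.inv_mem_of_homotopy (fun τ => (1 + RatFunc.C τ • A).det)
    (fun τ => Matrix.det_mem _ fun i j =>
      add_mem (Matrix.one_apply_mem _ i j) (mul_mem (TF.C_mem_stableSubring τ) (hA i j)))
    ?_ (by simp) ?_
  · simpa using this
  · have hc : Continuous (freqResp A) :=
      continuous_iff_continuousAt.2 fun ω => continuousAt_freqResp (hreg ω)
    have : Continuous fun p : ℝ × ℝ≥0∞ => (1 + (p.1 : ℂ) • freqResp A p.2).det := by
      fun_prop
    exact this.congr fun p => (resp_det_one_add_smul (hreg p.2) p.1).symm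
  · intro τ hτ ω
    simp only [resp_det_one_add_smul (hreg ω)]
    exact hne τ hτ ω

theorem isUnit_det_one_add {A : Matrix n n TF} (hA : RHInf A)
    (hne : ∀ ω, (1 + freqResp A ω).det ≠ 0) : IsUnit (1 + A).det := by
  rw [isUnit_iff_ne_zero]
  intro h
  have := resp_det_one_add_smul (hA.regularAt 0) 1
  rw [map_one, one_smul, h, Complex.ofReal_one, one_smul, ← map_zero RatFunc.C,
    (TF.regularAt_C 0 0).2] at this
  exact hne 0 (by simpa using this.symm)

/-- The frequency-wise criterion for feedback stability of two stable systems. -/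
theorem feedbackStable_of_det_ne_zero {G H : Matrix n n TF} (hG : RHInf G) (hH : RHInf H)
    (hne : ∀ τ ∈ Set.Icc (0 : ℝ) 1, ∀ ω,
      (1 + (τ : ℂ) • (freqResp H ω * freqResp G ω)).det ≠ 0) : FeedbackStable G H := by
  have hHG : RHInf (H * G) := by
    rw [rhInf_iff_mem] at *
    exact Matrix.mul_apply_mem _ hH hG
  have hresp : ∀ ω, freqResp (H * G) ω = freqResp H ω * freqResp G ω := fun ω =>
    freqResp_mul (hH.regularAt ω) (hG.regularAt ω)
  refine ⟨isUnit_det_one_add hHG fun ω => ?_, ?_⟩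
  · simpa [hresp] using hne 1 (by simp) ω
  have hdet := det_one_add_inv_mem hHG (by simpa only [hresp] using hne)
  rw [rhInf_iff_mem] at *
  have hI := Matrix.inv_apply_mem TF.stableSubring
    (fun i j => add_mem (Matrix.one_apply_mem _ i j) (hHG i j)) hdet
  rintro (i | i) (j | j)
  · exact hI i j
  · exact Matrix.mul_apply_mem _ hI hH i j
  · exact Matrix.mul_apply_mem _ hG hI i j
  · exact Matrix.mul_apply_mem _ (Matrix.mul_apply_mem _ hG hI) hH i j

/-- The smallest singular value of `Y(jω)`, in the sense of a limit inferior at poles, bounds the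
gain of a stable inverse of `Y` from above. -/
theorem exists_gain_bound_of_lt_sigmaMinAt [Nonempty n] {Y H : Matrix n n TF} (hHY : H * Y = 1)
    (hH : RHInf H) {ω : ℝ≥0∞} {a : ℝ} (h : ENNReal.ofReal a < sigmaMinAt Y ω) :
    ∃ c, a < c ∧ ∀ x, c * ‖WithLp.toLp 2 (freqResp H ω *ᵥ x)‖ ≤ ‖WithLp.toLp 2 x‖ := by
  have hYH : Y * H = 1 := mul_eq_one_comm.1 hHY
  have key : ∀ {t} (c : ℝ), RegularAt Y t → c ≤ sigmaMin (freqResp Y t) → ∀ x : n → ℂ,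
      c * ‖WithLp.toLp 2 (freqResp H t *ᵥ x)‖ ≤ ‖WithLp.toLp 2 x‖ := by
    intro t c hY hc x
    have h1 := sigmaMin_mul_norm_le (freqResp Y t) (freqResp H t *ᵥ x)
    rw [Matrix.mulVec_mulVec, ← freqResp_mul hY (hH.regularAt t), hYH, freqResp_one,
      Matrix.one_mulVec] at h1
    exact (mul_le_mul_of_nonneg_right hc (norm_nonneg _)).trans h1
  by_cases hY : RegularAt Y ω
  · rw [sigmaMinAt, if_pos hY] at h
    exact ⟨_, (ENNReal.ofReal_lt_ofReal_iff'.1 h).1, key _ hY le_rfl⟩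
  · rw [sigmaMinAt, if_neg hY] at h
    obtain ⟨c, hac, hc⟩ := ENNReal.lt_iff_exists_nnreal_btwn.1 h
    refine ⟨c, ?_, fun x => ?_⟩
    · rw [← ENNReal.ofReal_coe_nnreal] at hac
      exact (ENNReal.ofReal_lt_ofReal_iff'.1 hac).1
    have hev := eventually_lt_of_lt_liminf hc
    have hregev : ∀ᶠ t in 𝓝[≠] ω, RegularAt Y t :=
      eventually_all.2 fun i => eventually_all.2 fun j => TF.eventually_regularAt _ _
    have hcont : ContinuousAt
        (fun t => (c : ℝ) * ‖WithLp.toLp 2 (freqResp H t *ᵥ x)‖) ω := by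
      have := continuousAt_freqResp (hH.regularAt ω)
      have h2 : Continuous fun M : Matrix n n ℂ => (c : ℝ) * ‖WithLp.toLp 2 (M *ᵥ x)‖ := by
        fun_prop
      exact h2.continuousAt.comp this
    refine le_of_tendsto (b := ‖WithLp.toLp 2 x‖) (x := 𝓝[≠] ω)
      (hcont.tendsto.mono_left nhdsWithin_le_nhds) ?_
    filter_upwards [hev, hregev] with t ht hreg
    rw [← ENNReal.ofReal_coe_nnreal] at ht
    exact key _ hreg (ENNReal.ofReal_lt_ofReal_iff'.1 ht).1.le x

end TransferMatrices

/-! ### Block diagonal matrices -/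

section BlockDiagonal

open WithLp MultiConverterSystem

variable {N : ℕ}

/-- The complex block diagonal matrix `diag(A_1, …, A_N)` with `2 × 2` blocks. -/
noncomputable def complexBlockDiag (A : Fin N → Matrix (Fin 2) (Fin 2) ℂ) :
    Matrix (Fin N × Fin 2) (Fin N × Fin 2) ℂ :=
  (Matrix.blockDiagonal A).submatrix Prod.swap Prod.swap

theorem freqResp_blockDiag (B : Fin N → Matrix (Fin 2) (Fin 2) TF) (ω : ℝ≥0∞) :
    freqResp (blockDiag B) ω = complexBlockDiag fun i => freqResp (B i) ω := by
  ext ⟨i, k⟩ ⟨j, l⟩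
  have h0 : TF.resp 0 ω = 0 := (TF.respHom ω).map_zero
  simp only [freqResp, blockDiag, complexBlockDiag, Matrix.of_apply, Matrix.submatrix_apply,
    Prod.swap_prod_mk, Matrix.blockDiagonal_apply]
  split_ifs
  exacts [rfl, h0]

theorem blockDiag_mul (A B : Fin N → Matrix (Fin 2) (Fin 2) TF) :
    blockDiag A * blockDiag B = blockDiag fun i => A i * B i := by
  rw [blockDiag, blockDiag, blockDiag, Matrix.blockDiagonal_mul]
  exact Matrix.submatrix_mul_equiv _ _ _ (Equiv.prodComm _ _) _

theorem blockDiag_one : blockDiag (fun _ : Fin N => (1 : Matrix (Fin 2) (Fin 2) TF)) = 1 := by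
  have h : Matrix.blockDiagonal (fun _ : Fin N => (1 : Matrix (Fin 2) (Fin 2) TF)) = 1 :=
    Matrix.blockDiagonal_one
  rw [blockDiag, h]
  exact Matrix.submatrix_one _ Prod.swap_injective

theorem blockDiag_apply_mem (S : Subring TF) {B : Fin N → Matrix (Fin 2) (Fin 2) TF}
    (h : ∀ i k l, B i k l ∈ S) (p q : Fin N × Fin 2) : blockDiag B p q ∈ S := by
  rw [blockDiag, Matrix.submatrix_apply, Matrix.blockDiagonal_apply]
  split_ifs
  exacts [h _ _ _, zero_mem S]

theorem constDiag_kronecker (d : Fin N → ℝ) (B : Matrix (Fin 2) (Fin 2) TF) :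
    constDiag d ⊗ₖ B = blockDiag fun i => RatFunc.C (d i) • B := by
  ext ⟨i, k⟩ ⟨j, l⟩
  simp only [constDiag, blockDiag, Matrix.kroneckerMap_apply, Matrix.submatrix_apply,
    Prod.swap_prod_mk, Matrix.blockDiagonal_apply, Matrix.diagonal_apply]
  split_ifs <;> simp

theorem complexBlockDiag_mulVec (A : Fin N → Matrix (Fin 2) (Fin 2) ℂ) (x : Fin N × Fin 2 → ℂ)
    (i : Fin N) (k : Fin 2) :
    (complexBlockDiag A *ᵥ x) (i, k) = (A i *ᵥ fun l => x (i, l)) k := by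
  simp only [Matrix.mulVec, dotProduct, complexBlockDiag, Matrix.submatrix_apply,
    Prod.swap_prod_mk, Matrix.blockDiagonal_apply, Fintype.sum_prod_type]
  rw [Finset.sum_eq_single i (fun j _ hj => by simp [hj.symm]) (by simp)]
  simp

theorem norm_complexBlockDiag_mulVec_le (A : Fin N → Matrix (Fin 2) (Fin 2) ℂ) {a : ℝ}
    (ha : 0 ≤ a) (hA : ∀ i, sigmaMax (A i) ≤ a) (x : Fin N × Fin 2 → ℂ) :
    ‖toLp 2 (complexBlockDiag A *ᵥ x)‖ ≤ a * ‖toLp 2 x‖ := by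
  refine le_of_sq_le_sq ?_ (mul_nonneg ha (norm_nonneg _))
  rw [mul_pow, EuclideanSpace.norm_sq_eq, EuclideanSpace.norm_sq_eq, Fintype.sum_prod_type,
    Fintype.sum_prod_type, Finset.mul_sum]
  refine Finset.sum_le_sum fun i _ => ?_
  have h : ‖toLp 2 (A i *ᵥ fun l => x (i, l))‖ ≤ a * ‖toLp 2 fun l => x (i, l)‖ :=
    (norm_mulVec_le_sigmaMax _ _).trans (mul_le_mul_of_nonneg_right (hA i) (norm_nonneg _))
  have h2 := pow_le_pow_left₀ (norm_nonneg _) h 2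
  rw [mul_pow, EuclideanSpace.norm_sq_eq, EuclideanSpace.norm_sq_eq] at h2
  simpa only [complexBlockDiag_mulVec] using h2

theorem complexBlockDiag_mul (A B : Fin N → Matrix (Fin 2) (Fin 2) ℂ) :
    complexBlockDiag A * complexBlockDiag B = complexBlockDiag fun i => A i * B i := by
  rw [complexBlockDiag, complexBlockDiag, complexBlockDiag, Matrix.blockDiagonal_mul]
  exact Matrix.submatrix_mul_equiv _ _ _ (Equiv.prodComm _ _) _

theorem complexBlockDiag_conjTranspose (A : Fin N → Matrix (Fin 2) (Fin 2) ℂ) :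
    (complexBlockDiag A)ᴴ = complexBlockDiag fun i => (A i)ᴴ := by
  rw [complexBlockDiag, complexBlockDiag, Matrix.conjTranspose_submatrix,
    Matrix.blockDiagonal_conjTranspose]

theorem complexBlockDiag_diagonal (d : Fin N → Fin 2 → ℂ) :
    complexBlockDiag (fun i => Matrix.diagonal (d i)) = Matrix.diagonal fun p => d p.1 p.2 := by
  ext ⟨i, k⟩ ⟨j, l⟩
  by_cases hij : i = j <;> by_cases hkl : k = l <;>
    simp [complexBlockDiag, hij, hkl]

theorem det_complexBlockDiag (A : Fin N → Matrix (Fin 2) (Fin 2) ℂ) :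
    (complexBlockDiag A).det = ∏ i, (A i).det := by
  rw [← Matrix.det_blockDiagonal]
  exact Matrix.det_submatrix_equiv_self (Equiv.prodComm _ _) _

theorem norm_mulVec_of_conjTranspose_mul_self {n : Type*} [Fintype n] [DecidableEq n]
    {U : Matrix n n ℂ} (hU : Uᴴ * U = 1) (x : n → ℂ) : ‖toLp 2 (U *ᵥ x)‖ = ‖toLp 2 x‖ := by
  have hU' : U ∈ Matrix.unitaryGroup n ℂ := Matrix.mem_unitaryGroup_iff'.2 hU
  rw [← sq_eq_sq₀ (norm_nonneg _) (norm_nonneg _), ← Complex.ofReal_inj]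
  push_cast
  have h : ∀ y : n → ℂ, ((‖toLp 2 y‖ : ℂ) ^ 2) = star y ⬝ᵥ y := fun y => by
    rw [← RCLike.ofReal_eq_complex_ofReal, ← inner_self_eq_norm_sq_to_K,
      EuclideanSpace.inner_eq_star_dotProduct, dotProduct_comm]
  rw [h, h, Matrix.star_mulVec, ← Matrix.dotProduct_mulVec, Matrix.mulVec_mulVec, hU,
    Matrix.one_mulVec]

end BlockDiagonal

/-! ### The multi-converter loop -/

/-- Rescaling a loop does not create unstable poles: `G = R L` and `H = (Q⁻¹ Y Q⁻¹ L)⁻¹` arise from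
`G₀ = Q² R` and `H₀ = Y⁻¹` by the rescaling `L`, whose inverse may be unstable. It is not needed:
`(I + H₀ G₀)⁻¹ H₀ = Q⁻¹ L (I + H G)⁻¹ H Q⁻¹`, and the other closed-loop functions are
polynomials in this one and `G₀`. -/
theorem feedbackNoUnstablePole_of_rescaled {n : Type*} [Fintype n] [DecidableEq n]
    {R L Q P Y : Matrix n n TF} (hL : IsUnit L.det) (hQP : Q * P = 1) (hQR : Q * R = R * Q)
    (hRs : NoUnstablePole R) (hLs : NoUnstablePole L) (hQs : NoUnstablePole Q)
    (hPs : NoUnstablePole P) (h : FeedbackStable (R * L) (P * Y * (P * L))⁻¹) :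
    FeedbackNoUnstablePole (Q * Q * R) Y⁻¹ := by
  have hPQ : P * Q = 1 := mul_eq_one_comm.1 hQP
  set V := P * L with hVdef
  set H := (P * Y * V)⁻¹ with hHdef
  have hV : IsUnit V.det := by
    rw [hVdef, Matrix.det_mul]
    exact (Matrix.isUnit_det_of_right_inverse hPQ).mul hL
  have hVW : V * V⁻¹ = 1 := Matrix.mul_nonsing_inv V hV
  have hWV : V⁻¹ * V = 1 := Matrix.nonsing_inv_mul V hV
  have hH : V * H = Y⁻¹ * Q := by
    rw [hHdef, Matrix.mul_inv_rev _ V, Matrix.mul_inv_rev P Y, Matrix.inv_eq_right_inv hPQ,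
      ← mul_assoc V, hVW, one_mul]
  have hLV : L * V⁻¹ = Q := by
    rw [← one_mul L, ← hQP, mul_assoc Q, mul_assoc, ← hVdef, hVW, mul_one]
  have hH' : Y⁻¹ = V * H * P := by rw [hH, mul_assoc, hQP, mul_one]
  have hG : Q * Q * R = Q * R * Q := by rw [mul_assoc, hQR, ← mul_assoc, hQR]
  have hconj : 1 + Y⁻¹ * (Q * Q * R) = V * (1 + H * (R * L)) * V⁻¹ := by
    rw [mul_add, add_mul, mul_one, hVW, ← mul_assoc V H, hH, hG]
    simp only [mul_assoc, hLV]
  obtain ⟨hu, hstab⟩ := h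
  have hinv : (1 + Y⁻¹ * (Q * Q * R))⁻¹ = V * (1 + H * (R * L))⁻¹ * V⁻¹ := by
    refine Matrix.inv_eq_right_inv ?_
    rw [hconj, mul_assoc (V * _), mul_assoc V (_⁻¹), ← mul_assoc V⁻¹, hWV, one_mul, ← mul_assoc,
      mul_assoc V, Matrix.mul_nonsing_inv _ hu, mul_one, hVW]
  have hunit : IsUnit (1 + Y⁻¹ * (Q * Q * R)).det := by
    rw [hconj, Matrix.det_mul, Matrix.det_mul]
    exact (hV.mul hu).mul (Matrix.isUnit_nonsing_inv_det V hV)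
  refine ⟨hunit, ?_⟩
  set S := TF.unstablePoleFreeSubring
  have hT : ∀ i j, ((1 + Y⁻¹ * (Q * Q * R))⁻¹ * Y⁻¹) i j ∈ S := by
    have e : (1 + Y⁻¹ * (Q * Q * R))⁻¹ * Y⁻¹ = V * ((1 + H * (R * L))⁻¹ * H) * P := by
      rw [hinv, hH']
      simp only [mul_assoc]
      rw [← mul_assoc V⁻¹ V, hWV, one_mul]
    rw [e]
    exact Matrix.mul_apply_mem S (Matrix.mul_apply_mem S (Matrix.mul_apply_mem S hPs hLs)
      fun i j => (hstab (Sum.inl i) (Sum.inr j)).2) hPs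
  have hG0 : ∀ i j, (Q * Q * R) i j ∈ S :=
    Matrix.mul_apply_mem S (Matrix.mul_apply_mem S hQs hQs) hRs
  have hI : ∀ i j, (1 + Y⁻¹ * (Q * Q * R))⁻¹ i j ∈ S := by
    have e : (1 + Y⁻¹ * (Q * Q * R))⁻¹ =
        1 - (1 + Y⁻¹ * (Q * Q * R))⁻¹ * Y⁻¹ * (Q * Q * R) := by
      have h1 := Matrix.nonsing_inv_mul _ hunit
      rwa [mul_add, mul_one, ← mul_assoc _ Y⁻¹, ← eq_sub_iff_add_eq] at h1
    intro i j
    rw [e]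
    exact sub_mem (Matrix.one_apply_mem S i j) (Matrix.mul_apply_mem S hT hG0 i j)
  rintro (i | i) (j | j)
  · exact hI i j
  · exact hT i j
  · exact Matrix.mul_apply_mem S hG0 hI i j
  · have := Matrix.mul_apply_mem S hG0 hT i j
    rwa [← mul_assoc] at this

namespace MultiConverterSystem

variable {N K : ℕ} (sys : MultiConverterSystem N K)

theorem rot_mul_rot_neg (t : ℝ) : rot t * rot (-t) = 1 := by
  have h : (RatFunc.C (Real.cos t) * RatFunc.C (Real.cos t) +
      RatFunc.C (Real.sin t) * RatFunc.C (Real.sin t) : TF) = 1 := by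
    rw [← map_mul, ← map_mul, ← map_add, ← sq, ← sq, Real.cos_sq_add_sin_sq, map_one]
  rw [rot, rot, Real.cos_neg, Real.sin_neg, map_neg, neg_neg, Matrix.mul_fin_two,
    Matrix.one_fin_two, neg_mul_neg, mul_neg, h,
    add_comm (RatFunc.C (Real.sin t) * RatFunc.C (Real.sin t)), h]
  ext i j
  fin_cases i <;> fin_cases j <;> simp <;> ring

theorem rot_mul_Finv (t ε : ℝ) : rot t * sys.Finv ε = sys.Finv ε * rot t := by
  rw [rot, Finv, Matrix.mul_fin_two, Matrix.mul_fin_two]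
  ext i j
  fin_cases i <;> fin_cases j <;> simp <;> ring

theorem rotatedYC_eq : sys.rotatedYC =
    blockDiag fun i => rot (sys.θ i) * sys.YC i * rot (-sys.θ i) := by
  rw [rotatedYC, blockDiag_mul, blockDiag_mul]

/-- Rotations commute with `F_ε⁻¹`, so the rescaling passes through the change of coordinates. -/
theorem devicesT_eq (D : Fin N → ℝ) (ε : ℝ) : sys.devicesT D ε =
    blockDiag (fun i => rot (sys.θ i)) * blockDiag (sys.YCT D ε) *
      blockDiag (fun i => rot (-sys.θ i)) := by
  rw [devicesT, rotatedYC_eq, constDiag_kronecker, blockDiag_mul, blockDiag_mul, blockDiag_mul]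
  congr 1
  funext i
  rw [YCT, mul_smul_comm, mul_smul_comm, smul_mul_assoc, mul_assoc (_ * _), rot_mul_Finv]
  simp only [mul_assoc]

theorem rot_apply_eq_C (t : ℝ) (k l : Fin 2) :
    rot t k l = RatFunc.C (!![Real.cos t, -Real.sin t; Real.sin t, Real.cos t] k l) := by
  fin_cases k <;> fin_cases l <;> simp [rot]

theorem rhInf_blockDiag_rot (t : Fin N → ℝ) : RHInf (blockDiag fun i => rot (t i)) := by
  rw [rhInf_iff_mem]
  refine blockDiag_apply_mem _ fun i k l => ?_
  rw [rot_apply_eq_C]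
  exact TF.C_mem_stableSubring _

theorem freqResp_rot_neg (t : ℝ) (ω : ℝ≥0∞) :
    freqResp (rot (-t)) ω = (freqResp (rot t) ω)ᴴ := by
  ext k l
  rw [Matrix.conjTranspose_apply]
  simp only [freqResp, Matrix.of_apply, rot_apply_eq_C, (TF.regularAt_C _ ω).2, Complex.star_def,
    Complex.conj_ofReal, Real.cos_neg, Real.sin_neg, neg_neg]
  fin_cases k <;> fin_cases l <;> rfl

/-- On the imaginary axis the device dynamics are unitarily similar to the block diagonal matrix of
the rescaled converters. -/
theorem exists_unitary_freqResp_devicesT {D : Fin N → ℝ} {ε : ℝ}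
    (hdev : ∀ i, RHInf (sys.YCT D ε i)) (ω : ℝ≥0∞) :
    ∃ U : Matrix (Fin N × Fin 2) (Fin N × Fin 2) ℂ, U * Uᴴ = 1 ∧
      freqResp (sys.devicesT D ε) ω =
        U * complexBlockDiag (fun i => freqResp (sys.YCT D ε i) ω) * Uᴴ := by
  have hY : RegularAt (blockDiag (sys.YCT D ε)) ω :=
    blockDiag_apply_mem (TF.regularSubring ω) fun i => (hdev i).regularAt ω
  have hR := (rhInf_blockDiag_rot sys.θ).regularAt ω
  have hR' := (rhInf_blockDiag_rot fun i => -sys.θ i).regularAt ω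
  have hU : freqResp (blockDiag fun i => rot (-sys.θ i)) ω =
      (freqResp (blockDiag fun i => rot (sys.θ i)) ω)ᴴ := by
    rw [freqResp_blockDiag, freqResp_blockDiag, complexBlockDiag_conjTranspose]
    simp only [freqResp_rot_neg]
  refine ⟨freqResp (blockDiag fun i => rot (sys.θ i)) ω, ?_, ?_⟩
  · rw [← hU, ← freqResp_mul hR hR', blockDiag_mul]
    simp only [rot_mul_rot_neg, blockDiag_one, freqResp_one]
  · rw [← hU, devicesT_eq, ← freqResp_blockDiag,
      freqResp_mul (Matrix.mul_apply_mem (TF.regularSubring ω) hR hY) hR', freqResp_mul hR hY]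

theorem rhInf_devicesT {D : Fin N → ℝ} {ε : ℝ} (hdev : ∀ i, RHInf (sys.YCT D ε i)) :
    RHInf (sys.devicesT D ε) := by
  rw [devicesT_eq]
  have h1 := rhInf_blockDiag_rot sys.θ
  have h2 := rhInf_blockDiag_rot fun i => -sys.θ i
  rw [rhInf_iff_mem] at *
  exact Matrix.mul_apply_mem _ (Matrix.mul_apply_mem _ h1
    (blockDiag_apply_mem _ fun i => rhInf_iff_mem.1 (hdev i))) h2

theorem isUnit_det_Finv (ε : ℝ) : IsUnit (sys.Finv ε).det := by
  rw [isUnit_iff_ne_zero, Finv, Matrix.det_fin_two_of]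
  have h : (sVar / RatFunc.C sys.ω₀ + RatFunc.C ε) * (sVar / RatFunc.C sys.ω₀ + RatFunc.C ε) -
      -1 * 1 = algebraMap (Polynomial ℝ) TF
        ((Polynomial.X * Polynomial.C sys.ω₀⁻¹ + Polynomial.C ε) ^ 2 + 1) := by
    simp only [map_add, map_pow, map_mul, RatFunc.algebraMap_X, RatFunc.algebraMap_C, map_one,
      map_inv₀, sVar]
    ring
  rw [h]
  refine RatFunc.algebraMap_ne_zero fun h0 => ?_
  have := congrArg (Polynomial.eval 0) h0
  simp only [Polynomial.eval_add, Polynomial.eval_pow, Polynomial.eval_mul, Polynomial.eval_X,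
    Polynomial.eval_C, Polynomial.eval_one, Polynomial.eval_zero, zero_mul, zero_add] at this
  nlinarith [sq_nonneg ε]

theorem noUnstablePole_Finv (ε : ℝ) : NoUnstablePole (sys.Finv ε) := by
  have hC : ∀ c : ℝ, (RatFunc.C c : TF) ∈ TF.unstablePoleFreeSubring := fun c =>
    (TF.C_mem_stableSubring c).2
  have hs : sVar ∈ TF.unstablePoleFreeSubring := fun s _ => by simp [sVar]
  have h : sVar / RatFunc.C sys.ω₀ + RatFunc.C ε ∈ TF.unstablePoleFreeSubring := by
    rw [div_eq_mul_inv, ← map_inv₀]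
    exact add_mem (mul_mem hs (hC _)) (hC _)
  intro i j
  fin_cases i <;> fin_cases j
  exacts [h, neg_mem (one_mem TF.unstablePoleFreeSubring), one_mem TF.unstablePoleFreeSubring, h]

theorem noUnstablePole_constDiag_kronecker (d : Fin N → ℝ) {B : Matrix (Fin 2) (Fin 2) TF}
    (hB : NoUnstablePole B) : NoUnstablePole (constDiag d ⊗ₖ B) := by
  rw [constDiag_kronecker]
  exact blockDiag_apply_mem TF.unstablePoleFreeSubring fun i k l =>
    mul_mem (TF.C_mem_stableSubring (d i)).2 (hB k l)

theorem noUnstablePole_rotatedYC (h : ∀ i, NoUnstablePole (sys.YC i)) :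
    NoUnstablePole sys.rotatedYC := by
  have hR : ∀ t : Fin N → ℝ, NoUnstablePole (blockDiag fun i => rot (t i)) := fun t i j =>
    (rhInf_blockDiag_rot t i j).2
  exact Matrix.mul_apply_mem TF.unstablePoleFreeSubring (Matrix.mul_apply_mem _ (hR _)
    (blockDiag_apply_mem _ h)) (hR fun i => -sys.θ i)

theorem constDiag_kronecker_one_mul (d e : Fin N → ℝ) :
    (constDiag d ⊗ₖ (1 : Matrix (Fin 2) (Fin 2) TF)) * (constDiag e ⊗ₖ 1) =
      constDiag (fun i => d i * e i) ⊗ₖ 1 := by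
  rw [← Matrix.mul_kronecker_mul, constDiag, constDiag, constDiag,
    Matrix.diagonal_mul_diagonal, one_mul]
  simp only [map_mul]

/-- The capacity ratios scale whole blocks, hence commute with the converter dynamics. -/
theorem constDiag_kronecker_one_comm (d : Fin N → ℝ) :
    (constDiag d ⊗ₖ (1 : Matrix (Fin 2) (Fin 2) TF)) * sys.rotatedYC =
      sys.rotatedYC * (constDiag d ⊗ₖ 1) := by
  rw [rotatedYC_eq, constDiag_kronecker, blockDiag_mul, blockDiag_mul]
  simp only [smul_mul_assoc, mul_smul_comm, one_mul, mul_one]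

theorem isUnit_det_constDiag_kronecker {d : Fin N → ℝ} (hd : ∀ i, d i ≠ 0)
    {B : Matrix (Fin 2) (Fin 2) TF} (hB : IsUnit B.det) : IsUnit (constDiag d ⊗ₖ B).det := by
  rw [Matrix.det_kronecker, constDiag, Matrix.det_diagonal]
  refine (IsUnit.pow _ ?_).mul (hB.pow _)
  rw [isUnit_iff_ne_zero, Finset.prod_ne_zero_iff]
  intro i _
  simpa using hd i

theorem YgridT_eq (D : Fin N → ℝ) (ε : ℝ) : sys.YgridT D ε =
    (constDiag (fun i => (Real.sqrt (sys.S i))⁻¹) ⊗ₖ (1 : Matrix (Fin 2) (Fin 2) TF)) *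
      sys.Ygrid * ((constDiag (fun i => (Real.sqrt (sys.S i))⁻¹) ⊗ₖ
        (1 : Matrix (Fin 2) (Fin 2) TF)) * (constDiag D ⊗ₖ sys.Finv ε)) := by
  rw [YgridT, ← Matrix.mul_kronecker_mul, constDiag, constDiag, constDiag,
    Matrix.diagonal_mul_diagonal, one_mul]
  simp only [map_mul]

theorem isUnit_det_YgridT {D : Fin N → ℝ} (hD : ∀ i, 0 < D i) (ε : ℝ)
    (hgrid : IsUnit sys.Ygrid.det) : IsUnit (sys.YgridT D ε).det := by
  have hS : IsUnit (constDiag (fun i => (Real.sqrt (sys.S i))⁻¹) ⊗ₖ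
      (1 : Matrix (Fin 2) (Fin 2) TF)).det :=
    isUnit_det_constDiag_kronecker
      (fun i => inv_ne_zero (Real.sqrt_ne_zero'.2 (sys.S_pos i))) (by simp)
  rw [YgridT_eq, Matrix.det_mul, Matrix.det_mul, Matrix.det_mul]
  exact (hS.mul hgrid).mul
    (hS.mul (isUnit_det_constDiag_kronecker (fun i => (hD i).ne') (sys.isUnit_det_Finv ε)))

theorem det_ne_zero_of_gainCondition (hN : 0 < N) {D : Fin N → ℝ} {ε : ℝ}
    (hY : IsUnit (sys.YgridT D ε).det) (hdev : ∀ i, RHInf (sys.YCT D ε i))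
    (hnet : RHInf (sys.YgridT D ε)⁻¹) {ω : ℝ≥0∞} (h : sys.GainCondition D ε ω) {τ : ℝ}
    (hτ : τ ∈ Set.Icc (0 : ℝ) 1) :
    (1 + (τ : ℂ) • (freqResp (sys.YgridT D ε)⁻¹ ω * freqResp (sys.devicesT D ε) ω)).det ≠ 0 := by
  have : Nonempty (Fin N) := ⟨⟨0, hN⟩⟩
  rw [GainCondition] at h
  set σ := ⨆ i, ENNReal.ofReal (sigmaMax (freqResp (sys.YCT D ε i) ω)) with hσ
  have hσtop : σ ≠ ⊤ := h.ne_top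
  have hle : ∀ i, sigmaMax (freqResp (sys.YCT D ε i) ω) ≤ σ.toReal := fun i =>
    (ENNReal.ofReal_le_iff_le_toReal hσtop).1
      (le_iSup (fun i => ENNReal.ofReal (sigmaMax (freqResp (sys.YCT D ε i) ω))) i)
  rw [← ENNReal.ofReal_toReal hσtop] at h
  obtain ⟨c, hac, hc⟩ :=
    exists_gain_bound_of_lt_sigmaMinAt (Matrix.nonsing_inv_mul _ hY) hnet h
  obtain ⟨U, hU, hG⟩ := sys.exists_unitary_freqResp_devicesT hdev ω
  refine det_one_add_ne_zero_of_gain ENNReal.toReal_nonneg hac (fun x => ?_) hc hτ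
  rw [hG, ← Matrix.mulVec_mulVec, ← Matrix.mulVec_mulVec,
    norm_mulVec_of_conjTranspose_mul_self (mul_eq_one_comm.1 hU)]
  refine (norm_complexBlockDiag_mulVec_le _ ENNReal.toReal_nonneg hle _).trans_eq ?_
  rw [norm_mulVec_of_conjTranspose_mul_self (by rwa [Matrix.conjTranspose_conjTranspose])]

theorem det_ne_zero_of_phaseCondition (hN : 0 < N) {D : Fin N → ℝ} {ε : ℝ}
    (hdev : ∀ i, RHInf (sys.YCT D ε i)) {ω : ℝ≥0∞} (h : sys.PhaseCondition D ε ω) {τ : ℝ}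
    (hτ : 0 ≤ τ) :
    (1 + (τ : ℂ) • (freqResp (sys.YgridT D ε)⁻¹ ω * freqResp (sys.devicesT D ε) ω)).det ≠ 0 := by
  have : Nonempty (Fin N) := ⟨⟨0, hN⟩⟩
  obtain ⟨φ, ψ, hφ, ⟨⟨T, hT, hB⟩, hψ⟩, ha, hb, -, hd⟩ := h
  choose S hS hA using fun i => (hφ i).1
  obtain ⟨U, hU, hG⟩ := sys.exists_unitary_freqResp_devicesT hdev ω
  have hsup : ∀ i k, φ i k ≤ ⨆ i, ⨆ k, φ i k := fun i k =>
    (le_ciSup (Finite.bddAbove_range (φ i)) k).trans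
      (le_ciSup (Finite.bddAbove_range fun i => ⨆ k, φ i k) i)
  have hinf : ∀ i k, ⨅ i, ⨅ k, φ i k ≤ φ i k := fun i k =>
    (ciInf_le (Finite.bddBelow_range fun i => ⨅ k, φ i k) i).trans
      (ciInf_le (Finite.bddBelow_range (φ i)) k)
  have hψsup : ∀ p, ψ p ≤ ⨆ p, ψ p := le_ciSup (Finite.bddAbove_range ψ)
  have hψinf : ∀ p, ⨅ p, ψ p ≤ ψ p := ciInf_le (Finite.bddBelow_range ψ)
  obtain ⟨γ, hγ⟩ := exists_cos_sub_pos
    (Sum.elim (fun p : Fin N × Fin 2 => φ p.1 p.2) fun p => -ψ p) (by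
      rintro (p | p) (q | q) <;> simp only [Sum.elim_inl, Sum.elim_inr]
      · linarith [hsup p.1 p.2, hinf q.1 q.2]
      · linarith [hsup p.1 p.2, hψsup q]
      · linarith [hinf q.1 q.2, hψinf p]
      · linarith [hψ q p])
  refine det_one_add_ne_zero_of_phase (S := complexBlockDiag S * Uᴴ) ?_ hT
    (φ := fun p => φ p.1 p.2) ?_ hB (fun p => hγ (Sum.inl p)) (fun p => hγ (Sum.inr p)) hτ
  · rw [Matrix.det_mul, det_complexBlockDiag]
    refine IsUnit.mul ?_ (Matrix.isUnit_det_of_left_inverse hU)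
    rw [isUnit_iff_ne_zero, Finset.prod_ne_zero_iff]
    exact fun i _ => (hS i).ne_zero
  · rw [hG, Matrix.conjTranspose_mul, Matrix.conjTranspose_conjTranspose,
      complexBlockDiag_conjTranspose, ← complexBlockDiag_diagonal fun i k =>
        Complex.exp ((φ i k : ℂ) * Complex.I)]
    simp only [hA, ← complexBlockDiag_mul, mul_assoc]

/-- The loop before rescaling inherits the absence of unstable poles from the rescaled loop. -/
theorem feedbackNoUnstablePole_devices {D : Fin N → ℝ} (hD : ∀ i, 0 < D i) {ε : ℝ}
    (hYC : ∀ i, NoUnstablePole (sys.YC i))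
    (hstab : FeedbackStable (sys.devicesT D ε) (sys.YgridT D ε)⁻¹) :
    FeedbackNoUnstablePole sys.devices sys.Ygrid⁻¹ := by
  have hS : ∀ i, Real.sqrt (sys.S i) ≠ 0 := fun i => Real.sqrt_ne_zero'.2 (sys.S_pos i)
  have hone : NoUnstablePole (1 : Matrix (Fin 2) (Fin 2) TF) :=
    Matrix.one_apply_mem TF.unstablePoleFreeSubring
  have hdevices : sys.devices =
      (constDiag (fun i => Real.sqrt (sys.S i)) ⊗ₖ 1) *
        (constDiag (fun i => Real.sqrt (sys.S i)) ⊗ₖ 1) * sys.rotatedYC := by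
    rw [constDiag_kronecker_one_mul, devices]
    simp only [Real.mul_self_sqrt (sys.S_pos _).le]
  rw [hdevices]
  rw [YgridT_eq, devicesT] at hstab
  refine feedbackNoUnstablePole_of_rescaled
    (isUnit_det_constDiag_kronecker (fun i => (hD i).ne')
      (sys.isUnit_det_Finv ε)) ?_ (sys.constDiag_kronecker_one_comm _)
    (sys.noUnstablePole_rotatedYC hYC)
    (noUnstablePole_constDiag_kronecker D (sys.noUnstablePole_Finv ε))
    (noUnstablePole_constDiag_kronecker _ hone)
    (noUnstablePole_constDiag_kronecker _ hone) hstab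
  rw [constDiag_kronecker_one_mul]
  simp only [mul_inv_cancel₀ (hS _), constDiag, map_one,
    Matrix.diagonal_one, Matrix.one_kronecker_one]

end MultiConverterSystem

theorem proposition1 {N K : ℕ} (hN : 0 < N) (sys : MultiConverterSystem N K)
    (D : Fin N → ℝ) (hD : ∀ i, 0 < D i) (ε : ℝ)
    (hKron : IsUnit sys.Y₄.det) (hgrid : IsUnit sys.Ygrid.det)
    (hdev : ∀ i, RHInf (sys.YCT D ε i))
    (hnet : RHInf (sys.YgridT D ε)⁻¹)
    (hcond : ∀ ω : ℝ≥0∞, sys.GainCondition D ε ω ∨ sys.PhaseCondition D ε ω) :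
    FeedbackStable (sys.devicesT D ε) (sys.YgridT D ε)⁻¹ ∧
      ((∀ i, NoUnstablePole (sys.YC i)) →
        FeedbackNoUnstablePole sys.devices sys.Ygrid⁻¹) := by
  have hstab : FeedbackStable (sys.devicesT D ε) (sys.YgridT D ε)⁻¹ :=
    feedbackStable_of_det_ne_zero (sys.rhInf_devicesT hdev) hnet fun τ hτ ω =>
      (hcond ω).elim
        (fun h => sys.det_ne_zero_of_gainCondition hN (sys.isUnit_det_YgridT hD ε hgrid) hdev hnet
          h hτ)
        fun h => sys.det_ne_zero_of_phaseCondition hN hdev h hτ.1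
  exact ⟨hstab, fun hYC => sys.feedbackNoUnstablePole_devices hD hYC hstab⟩
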